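/- Let $q=3^r$ with $r\ge 1$, let $\lambda(x)=e^{2\pi i\,\mathrm{tr}(x)/3}$ be the canonical additive character of $\mathbb F_q$, where $\mathrm{tr}$ is the trace $\mathbb F_q\to\mathbb F_3$. For $a\in\mathbb F_q^*$ put $K(a)=\sum_{\alpha\in\mathbb F_q^*}\lambda(\alpha+a\alpha^{-1})$, and for $h\ge 0$ let $$SK^h=\sum_{a\in\mathbb F_q^*,\ a\ \text{square}}K(a)^h .$$ Let $N_1=|Sp(2,q)|$ and $N_2=|Sp(4,q)|$, let $g_1,\dots,g_{N_i}$ be any ordering of the elements of $Sp(2i,q)$ $(i=1,2)$, and let $$C(Sp(2i,q))=\Big\{u\in\mathbb F_3^{N_i}\ :\ \sum_{k}u_k\,\mathrm{Tr}(g_k)=0\ \text{in}\ \mathbb F_q\Big\},$$ a ternary linear code of length $N_i$; let $C_{i,j}$ be the number of its codewords of Hamming weight $j$. Let $n_i(\beta)$ be the number of elements of $Sp(2i,q)$ with trace $\beta$. For nonnegative integers $a,b,c$ put $\binom{c}{a,b}=\frac{c!}{a!\,b!\,(c-a-b)!}$ if $a+b\le c$ and $\binom{c}{a,b}=0$ otherwise;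 binomial coefficients with negative lower entry are $0$. Let $S(h,t)=\frac1{t!}\sum_{j=0}^t(-1)^{t-j}\binom tj j^h$ (with $0^0=1$), which is the Stirling number of the second kind. For $\beta\in\mathbb F_q$ let $\delta(\beta)=|\{(\alpha_1,\alpha_2)\in(\mathbb F_q^*)^2 : \alpha_1+\alpha_1^{-1}+\alpha_2+\alpha_2^{-1}=\beta\}|$. (a) $N_1=q(q^2-1)$, and for every $h\ge 1$ $$SK^h=\sum_{j=0}^{h-1}(-1)^{h+j+1}\binom hj(q^2-1)^{h-j}SK^j+q^{1-h}\sum_{j=0}^{\min\{N_1,h\}}(-1)^{h+j}C_{1,j}\sum_{t=j}^h t!\,S(h,t)\,3^{h-t}2^{t-h-j-1}\binom{N_1-j}{N_1-t},$$ where, for $0\le j\le N_1$, $$C_{1,j}=\sum\binom{q^2}{\nu_1,\mu_1}\binom{q^2}{\nu_{-1},\mu_{-1}}\prod_{\beta^2-1\ne0\ \text{square}}\binom{q^2+q}{\nu_\beta,\mu_\beta}\prod_{\beta^2-1\ \text{nonsquare}}\binom{q^2-q}{\nu_\beta,\mu_\beta}.$$ The upper entries are the numbers $n_1(\beta)$: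 $n_1(\pm1)=q^2$, $n_1(\beta)=q^2+q$ if $\beta^2-1$ is a nonzero square, and $n_1(\beta)=q^2-q$ if $\beta^2-1$ is a nonsquare. (b) $N_2=q^4(q^2-1)(q^4-1)$, and for every $h\ge 1$ $$SK^{2h}=\sum_{j=0}^{h-1}(-1)^{h+j+1}\binom hj(q^6-q^4-q^3-q^2+q+1)^{h-j}SK^{2j}+q^{1-4h}\sum_{j=0}^{\min\{N_2,h\}}(-1)^{h+j}C_{2,j}\sum_{t=j}^h t!\,S(h,t)\,3^{h-t}2^{t-h-j-1}\binom{N_2-j}{N_2-t},$$ where, for $0\le j\le N_2$, $$C_{2,j}=\sum\binom{q^4(\delta(0)+q^5-q^2-3q+3)}{\nu_0,\mu_0}\prod_{\beta\in\mathbb F_q^*}\binom{q^4(\delta(\beta)+q^5-q^3-q^2-2q+3)}{\nu_\beta,\mu_\beta}.$$ The upper entries are the numbers $n_2(\beta)$: $n_2(0)=q^4(\delta(0)+q^5-q^2-3q+3)$, and $n_2(\beta)=q^4(\delta(\beta)+q^5-q^3-q^2-2q+3)$ for $\beta\ne0$. In both formulas for $C_{i,j}$ the outer sum is over all families of nonnegative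 integers $(\nu_\beta)_{\beta\in\mathbb F_q}$, $(\mu_\beta)_{\beta\in\mathbb F_q}$ with $\sum_\beta\nu_\beta+\sum_\beta\mu_\beta=j$ and $\sum_\beta\nu_\beta\beta=\sum_\beta\mu_\beta\beta$ in $\mathbb F_q$. -/

import Mathlib

namespace SymplecticCodes

/-- The canonical additive character `x ↦ exp (2 π i tr(x) / 3)` of a finite field `F` of
characteristic three, where `tr : F → 𝔽₃` is the trace. -/
noncomputable def canonicalChar (F : Type*) [Field F] [Fintype F] [Algebra (ZMod 3) F] :
    AddChar F ℂ :=
  (ZMod.stdAddChar (N := 3)).compAddMonoidHom (Algebra.trace (ZMod 3) F).toAddMonoidHom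

/-- The Kloosterman sum `K(ψ; a) = ∑_{α ≠ 0} ψ(α + a α⁻¹)`. -/
noncomputable def kloosterman {F : Type*} [Field F] [Fintype F] (ψ : AddChar F ℂ) (a : Fˣ) : ℂ :=
  open Classical in ∑ α : Fˣ, ψ ((α : F) + (a : F) * (α : F)⁻¹)

/-- The `h`-th moment `SK(ψ)^h` of Kloosterman sums with square arguments: the sum of
`K(ψ; a)^h` over the nonzero squares `a`. -/
noncomputable def squareMoment {F : Type*} [Field F] [Fintype F] (ψ : AddChar F ℂ) (h : ℕ) : ℂ :=
  open Classical in ∑ a : Fˣ with IsSquare a, kloosterman ψ a ^ h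

/-- The moment `SK^h` for the canonical additive character. -/
noncomputable def SK (F : Type*) [Field F] [Fintype F] [Algebra (ZMod 3) F] (h : ℕ) : ℂ :=
  squareMoment (canonicalChar F) h

/-- The symplectic group `Sp(2n, F)`, consisting of `2n × 2n` matrices. -/
abbrev Sp (n : ℕ) (F : Type*) [Field F] : Submonoid (Matrix (Fin n ⊕ Fin n) (Fin n ⊕ Fin n) F) :=
  Matrix.symplecticGroup (Fin n) F

/-- The defining condition written as `ᵗw J w = J` with `J` having the blocks `0, 1, -1, 0`. -/
theorem mem_Sp_iff {n : ℕ} {F : Type*} [Field F]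
    (w : Matrix (Fin n ⊕ Fin n) (Fin n ⊕ Fin n) F) :
    w ∈ Sp n F ↔ w.transpose * Matrix.fromBlocks 0 1 (-1) 0 * w
      = Matrix.fromBlocks 0 1 (-1) 0 := by
  have hJ : (Matrix.fromBlocks 0 1 (-1) 0 : Matrix (Fin n ⊕ Fin n) (Fin n ⊕ Fin n) F)
      = -Matrix.J (Fin n) F := by
    simp [Matrix.J, Matrix.fromBlocks_neg]
  rw [SymplecticGroup.mem_iff', hJ]
  simp

/-- The number of elements of `Sp(2n, F)` of trace `β`. -/
noncomputable def traceCount (n : ℕ) (F : Type*) [Field F] (β : F) : ℕ :=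
  Nat.card {w : Sp n F // (w : Matrix (Fin n ⊕ Fin n) (Fin n ⊕ Fin n) F).trace = β}

/-- The ternary code `C(Sp(2n, F))` for the ordering `g` of the group elements: all vectors `u`
over `𝔽₃` with `∑ i, u i * Tr (g i) = 0` in `F`. -/
def code {n N : ℕ} {F : Type*} [Field F] [Algebra (ZMod 3) F] (g : Fin N ≃ Sp n F) :
    Submodule (ZMod 3) (Fin N → ZMod 3) where
  carrier := {u | ∑ i, algebraMap (ZMod 3) F (u i) *
    (g i : Matrix (Fin n ⊕ Fin n) (Fin n ⊕ Fin n) F).trace = 0}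
  add_mem' {u v} hu hv := by
    have hu' : _ = (0 : F) := hu
    have hv' : _ = (0 : F) := hv
    change _ = (0 : F)
    simp only [Pi.add_apply, map_add, add_mul, Finset.sum_add_distrib, hu', hv', add_zero]
  zero_mem' := by
    change _ = (0 : F)
    simp
  smul_mem' c u hu := by
    have hu' : _ = (0 : F) := hu
    change _ = (0 : F)
    simp only [Pi.smul_apply, smul_eq_mul, map_mul, mul_assoc, ← Finset.mul_sum, hu', mul_zero]

/-- The number of codewords of Hamming weight `j`. -/
noncomputable def weightCount {N : ℕ} (C : Submodule (ZMod 3) (Fin N → ZMod 3)) (j : ℕ) : ℕ :=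
  Nat.card {u : Fin N → ZMod 3 // u ∈ C ∧ hammingNorm u = j}

/-- The trinomial coefficient `c! / (a! b! (c - a - b)!)`, equal to `0` if `a + b > c`. -/
def trinomial (c a b : ℕ) : ℕ :=
  if a + b ≤ c then c.factorial / (a.factorial * b.factorial * (c - a - b).factorial) else 0

/-- The binomial coefficient `(N - j choose N - t)` for `j ≤ N`, with the usual value `0` if the
lower entry `N - t` is negative. -/
def chooseSub (N j t : ℕ) : ℕ := if t ≤ N then (N - j).choose (N - t) else 0

/-- The number of pairs `(α₁, α₂)` of nonzero elements with
`α₁ + α₁⁻¹ + α₂ + α₂⁻¹ = β`. -/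
noncomputable def delta2 {F : Type*} [Field F] (β : F) : ℕ :=
  Nat.card {p : Fˣ × Fˣ //
    (p.1 : F) + (p.1 : F)⁻¹ + (p.2 : F) + (p.2 : F)⁻¹ = β}

open Classical in
/-- All pairs of families `(ν, μ)` of natural numbers indexed by `F` with
`∑ ν_β + ∑ μ_β = j` and `∑ ν_β β = ∑ μ_β β` in `F`; see `mem_indexSet`. -/
noncomputable def indexSet (F : Type*) [Field F] [Fintype F] (j : ℕ) :
    Finset ((F → ℕ) × (F → ℕ)) :=
  ((Fintype.piFinset fun _ => Finset.range (j + 1)) ×ˢ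
    (Fintype.piFinset fun _ => Finset.range (j + 1))).filter fun p =>
      ∑ β, p.1 β + ∑ β, p.2 β = j ∧ ∑ β, (p.1 β : F) * β = ∑ β, (p.2 β : F) * β

theorem mem_indexSet {F : Type*} [Field F] [Fintype F] (j : ℕ) (p : (F → ℕ) × (F → ℕ)) :
    p ∈ indexSet F j ↔
      ∑ β, p.1 β + ∑ β, p.2 β = j ∧ ∑ β, (p.1 β : F) * β = ∑ β, (p.2 β : F) * β := by
  classical
  simp only [indexSet, Finset.mem_filter, Finset.mem_product, Fintype.mem_piFinset,
    Finset.mem_range, and_iff_right_iff_imp]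
  rintro ⟨h, -⟩
  refine ⟨fun β => ?_, fun β => ?_⟩
  · have := Finset.single_le_sum (f := p.1) (fun i _ => Nat.zero_le _) (Finset.mem_univ β)
    omega
  · have := Finset.single_le_sum (f := p.2) (fun i _ => Nat.zero_le _) (Finset.mem_univ β)
    omega

end SymplecticCodes

/-!
The trace vector `f = (Tr g₁, …, Tr g_N)` of the group carries everything: the code is the set of
ternary vectors orthogonal to `f`, and its dual consists of the words `(tr (a f₁), …, tr (a f_N))`
with `a ∈ F`. By Fourier analysis on `𝔽₃`, the weight of such a word is
`(2 N - G(a) - G(-a)) / 3`, where `G(a) = ∑ w, λ(a Tr w)` is the Gauss sum of the group. The Gauss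
sums are `q K(a²)` for `Sp(2, q)` and `q⁴ (K(a²)² + q³ - q)` for `Sp(4, q)`, so the power moments of
these weights are binomial combinations of the moments of Kloosterman sums over squares
(each square being `a²` for two values of `a`). On the other hand, the power moments are determined by
the weight enumerator of the code: this is the MacWilliams identity `sum_one_add_X_pow_traceWeight`,
followed by the expansion of `w ^ h` in binomial coefficients (`sum_traceWeight_pow`). Solving for the
highest moment gives `moment_recursion`.

The weight enumerator itself only depends on the number of group elements of each trace
(`weightCount_orthogonalCode`): on the positions of trace `β` one chooses `ν_β` entries `1` and `μ_β`
entries `-1`, and the word lies in the code iff `∑ ν_β β = ∑ μ_β β`.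

It remains to find the trace distributions. For `Sp(2, q) = SL(2, q)` this is a count of solutions of
`b c = a (β - a) - 1` (`traceCount_one_eq`). For `Sp(4, q)`, write the matrices in blocks `A, B, C, D`
of size two. Multiplication on the left by the unipotent matrix with blocks `1, X, 0, 1`, where `X` is
symmetric, fixes `C` and adds `tr (X C)` to the trace. Hence the trace is equidistributed over the
matrices with `C` not alternating (`card_trace_eq_of_not_isAlternating`). If `C` is alternating and
nonzero, then `A` and `D` are arbitrary matrices of trace zero, and `B` is determined. If `C = 0`, the
matrix is given by `A ∈ GL(2, q)` and a symmetric matrix, with trace `tr A + tr A⁻¹`; the same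
argument applied to `A` reduces the count to triangular matrices and the pairs counted by `delta2`
(`card_trace_add_trace_inv`). The number of remaining matrices follows from the order of `Sp(4, q)`,
which is found by counting orthogonal hyperbolic pairs of rows (`card_Sp_two`).
-/

namespace SymplecticCodes

/-! ### Power moments of the weights of a ternary code -/

section

open Finset Polynomial

/-- Both sides satisfy `E (h + 1) (t + 1) = (t + 1) * (E h (t + 1) + E h t)`. -/
theorem factorial_mul_stirlingSecond {R : Type*} [CommRing R] (h t : ℕ) :
    (t.factorial : R) * (Nat.stirlingSecond h t : R) =
      ∑ j ∈ range (t + 1), (-1 : R) ^ (t - j) * (t.choose j : R) * (j : R) ^ h := by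
  induction h generalizing t with
  | zero =>
    have h1 := add_pow (1 : R) (-1) t
    simp only [one_pow, one_mul, add_neg_cancel] at h1
    simp only [pow_zero, mul_one]
    rw [← h1]
    cases t <;> simp
  | succ h ih =>
    cases t with
    | zero => simp
    | succ t =>
      have h2 : ∑ j ∈ range (t + 1 + 1),
            (-1 : R) ^ (t + 1 - j) * (t.choose j : R) * (j : R) ^ h
          = -∑ j ∈ range (t + 1), (-1 : R) ^ (t - j) * (t.choose j : R) * (j : R) ^ h := by
        rw [sum_range_succ, Nat.choose_succ_self, ← sum_neg_distrib]
        simp only [Nat.cast_zero, mul_zero, zero_mul, add_zero]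
        refine sum_congr rfl fun j hj => ?_
        rw [Nat.succ_sub (Nat.lt_succ_iff.1 (mem_range.1 hj)), pow_succ]
        ring
      have h3 : ∀ j ∈ range (t + 1 + 1),
          (-1 : R) ^ (t + 1 - j) * ((t + 1).choose j : R) * (j : R) ^ (h + 1)
          = (t + 1 : R) * ((-1 : R) ^ (t + 1 - j) * ((t + 1).choose j : R) * (j : R) ^ h)
            - (t + 1 : R) * ((-1 : R) ^ (t + 1 - j) * (t.choose j : R) * (j : R) ^ h) := by
        intro j hj
        have h4 := congrArg (Nat.cast (R := R)) (Nat.choose_mul_succ_eq t j)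
        push_cast [Nat.cast_sub (Nat.lt_succ_iff.1 (mem_range.1 hj))] at h4
        linear_combination ((-1 : R) ^ (t + 1 - j) * (j : R) ^ h) * h4
      rw [sum_congr rfl h3, sum_sub_distrib, ← mul_sum, ← mul_sum, h2, ← ih, ← ih,
        Nat.stirlingSecond_succ_succ, Nat.factorial_succ]
      push_cast
      ring

theorem pow_eq_sum_stirlingSecond (w h : ℕ) :
    w ^ h = ∑ t ∈ range (h + 1), t.factorial * Nat.stirlingSecond h t * w.choose t := by
  have key : w ^ h = ∑ t ∈ range (h + 1), Nat.stirlingSecond h t * w.descFactorial t := by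
    induction h with
    | zero => simp
    | succ h ih =>
      have h1 : ∀ t, w * w.descFactorial t = w.descFactorial (t + 1) + t * w.descFactorial t := by
        intro t
        rcases le_or_gt t w with ht | ht
        · rw [Nat.descFactorial_succ, ← add_mul, Nat.sub_add_cancel ht]
        · simp [Nat.descFactorial_of_lt ht]
      have h2 : ∑ t ∈ range (h + 1), Nat.stirlingSecond h t * (t * w.descFactorial t)
          = ∑ t ∈ range (h + 1),
            (t + 1) * Nat.stirlingSecond h (t + 1) * w.descFactorial (t + 1) := by
        rw [sum_range_succ', sum_range_succ _ h, Nat.stirlingSecond_eq_zero_of_lt (Nat.lt_succ_self h)]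
        simp only [zero_mul, mul_zero, add_zero]
        exact sum_congr rfl fun t _ => by ring
      rw [pow_succ, ih, sum_range_succ' _ (h + 1), Nat.stirlingSecond_succ_zero, zero_mul, add_zero,
        sum_mul]
      calc _ = ∑ t ∈ range (h + 1), (Nat.stirlingSecond h t * w.descFactorial (t + 1)
              + Nat.stirlingSecond h t * (t * w.descFactorial t)) :=
            sum_congr rfl fun t _ => by rw [mul_assoc, mul_comm _ w, h1, mul_add]
        _ = _ := by
            rw [sum_add_distrib, h2, ← sum_add_distrib]
            exact sum_congr rfl fun t _ => by rw [Nat.stirlingSecond_succ_succ]; ring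
  rw [key]
  refine sum_congr rfl fun t _ => ?_
  rw [Nat.descFactorial_eq_factorial_mul_choose]
  ring

theorem choose_sub_eq_chooseSub {N j t : ℕ} (hjN : j ≤ N) (hjt : j ≤ t) :
    (N - j).choose (t - j) = chooseSub N j t := by
  unfold chooseSub
  split_ifs with h
  · exact Nat.choose_symm_of_eq_add (by omega)
  · exact Nat.choose_eq_zero_of_lt (by omega)

theorem addChar_map_sum {A R ι : Type*} [AddCommMonoid A] [CommMonoid R] (ψ : AddChar A R)
    (s : Finset ι) (x : ι → A) : ψ (∑ i ∈ s, x i) = ∏ i ∈ s, ψ (x i) := by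
  classical
  induction s using Finset.induction_on with
  | empty => simp
  | insert i s hi ih => rw [sum_insert hi, prod_insert hi, AddChar.map_add_eq_mul, ih]

section Character

variable {F : Type*} [Field F] [Algebra (ZMod 3) F]

/-- The ternary code of all vectors over `𝔽₃` orthogonal to a given vector `f` over `F`, as the kernel
of `u ↦ ∑ k, u k • f k`. -/
def orthogonalCode {N : ℕ} (f : Fin N → F) : Submodule (ZMod 3) (Fin N → ZMod 3) :=
  LinearMap.ker (∑ k, (LinearMap.toSpanSingleton (ZMod 3) F (f k)) ∘ₗ LinearMap.proj k)

theorem mem_orthogonalCode {N : ℕ} {f : Fin N → F} {u : Fin N → ZMod 3} :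
    u ∈ orthogonalCode f ↔ ∑ k, algebraMap (ZMod 3) F (u k) * f k = 0 := by
  simp [orthogonalCode, Algebra.smul_def]

theorem code_eq_orthogonalCode {n N : ℕ} (g : Fin N ≃ Sp n F) :
    code g = orthogonalCode fun k => (g k : Matrix (Fin n ⊕ Fin n) (Fin n ⊕ Fin n) F).trace := by
  ext u
  rw [mem_orthogonalCode]
  rfl

theorem three_eq_zero : (3 : F) = 0 := by
  have := map_natCast (algebraMap (ZMod 3) F) 3
  rw [show ((3 : ℕ) : ZMod 3) = 0 from rfl, map_zero] at this
  exact_mod_cast this.symm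

theorem ne_neg_self {x : F} (hx : x ≠ 0) : x ≠ -x := fun h =>
  hx (by linear_combination x * three_eq_zero (F := F) - h)

variable [Fintype F]

theorem canonicalChar_apply (x : F) :
    canonicalChar F x = ZMod.stdAddChar (Algebra.trace (ZMod 3) F x) := rfl

theorem canonicalChar_isPrimitive : (canonicalChar F).IsPrimitive := by
  apply AddChar.IsPrimitive.of_ne_one
  obtain ⟨x, hx⟩ := Algebra.trace_surjective (ZMod 3) F 1
  intro h
  have h1 : canonicalChar F x = 1 := by rw [h]; rfl
  rw [canonicalChar_apply, hx, ← AddChar.map_zero_eq_one (ZMod.stdAddChar (N := 3))] at h1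
  exact absurd (ZMod.injective_stdAddChar h1) (by decide)

theorem sum_canonicalChar_mul (b : F) [Decidable (b = 0)] :
    ∑ a : F, canonicalChar F (a * b) = if b = 0 then (Fintype.card F : ℂ) else 0 := by
  classical
  rw [AddChar.sum_mulShift b canonicalChar_isPrimitive]
  split_ifs <;> simp

theorem sum_stdAddChar_three (x : ZMod 3) :
    ∑ s : ZMod 3, ZMod.stdAddChar (s * x) = if x = 0 then (3 : ℂ) else 0 := by
  rw [AddChar.sum_mulShift x (ZMod.isPrimitive_stdAddChar 3)]
  split_ifs <;> simp

/-- The Hamming weight of the ternary word `(tr (a f₁), …, tr (a f_N))`; these words form the dual of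
the code orthogonal to `f`. -/
noncomputable def traceWeight {N : ℕ} (f : Fin N → F) (a : F) : ℕ :=
  hammingNorm fun k => Algebra.trace (ZMod 3) F (a * f k)

/-- The MacWilliams identity: the weight enumerator of the words `(tr (a f₁), …, tr (a f_N))`,
counted with multiplicity over `a`, in terms of that of the orthogonal code. It holds whether or not
`a ↦ (tr (a f₁), …, tr (a f_N))` is injective. -/
theorem sum_one_add_X_pow_traceWeight {N : ℕ} (f : Fin N → F) :
    ∑ a : F, (1 + X : ℂ[X]) ^ traceWeight f a =
      C (Fintype.card F : ℂ) * ∑ j ∈ range (N + 1), (weightCount (orthogonalCode f) j : ℂ[X]) *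
        ((C (-1 / 3 : ℂ) * X) ^ j * (1 + C (2 / 3 : ℂ) * X) ^ (N - j)) := by
  classical
  set e : ZMod 3 → ℂ[X] := fun s => if s ≠ 0 then C (-1 / 3 : ℂ) * X else 1 + C (2 / 3 : ℂ) * X
    with he
  -- the Fourier expansion of the function `x ↦ (1 + X)^[x ≠ 0]` on `𝔽₃`
  have hfour : ∀ x : ZMod 3, (if x ≠ 0 then (1 + X : ℂ[X]) else 1)
      = ∑ s, e s * C (ZMod.stdAddChar (s * x)) := by
    intro x
    have h1 : ∀ s, e s = (if s = 0 then 1 + X else 0) - C (1 / 3 : ℂ) * X := by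
      intro s
      by_cases hs : s = 0
      · have : C (2 / 3 : ℂ) = 1 - C (1 / 3 : ℂ) := by
          rw [← C_1, ← C_sub]; norm_num
        simp only [he, hs, ne_eq, not_true_eq_false, if_false, if_true, this]
        ring
      · simp only [he, hs, ne_eq, not_false_eq_true, if_false, if_true, zero_sub, neg_div, C_neg]
        ring
    simp only [h1, sub_mul, sum_sub_distrib, ite_mul, zero_mul, sum_ite_eq', mem_univ, if_true]
    rw [← mul_sum, ← map_sum C, sum_stdAddChar_three]
    by_cases hx : x = 0
    · simp only [hx, ne_eq, not_true_eq_false, if_false, if_true, AddChar.map_zero_eq_one,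
        C_1, mul_one]
      rw [mul_right_comm, ← C_mul]
      norm_num
    · simp [hx]
  have hprod : ∀ (P Q : ℂ[X]) (u : Fin N → ZMod 3),
      ∏ k, (if u k ≠ 0 then P else Q) = P ^ hammingNorm u * Q ^ (N - hammingNorm u) := by
    intro P Q u
    rw [prod_ite, prod_const, prod_const]
    have h1 := card_filter_add_card_filter_not (s := (univ : Finset (Fin N))) (fun k => u k ≠ 0)
    rw [card_univ, Fintype.card_fin] at h1
    have h2 : #{k | u k ≠ 0} = hammingNorm u := rfl
    rw [h2] at h1 ⊢
    congr 2
    omega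
  have hexp : ∀ a : F, (1 + X : ℂ[X]) ^ traceWeight f a
      = ∑ u : Fin N → ZMod 3,
          (C (-1 / 3 : ℂ) * X) ^ hammingNorm u * (1 + C (2 / 3 : ℂ) * X) ^ (N - hammingNorm u) *
          C (canonicalChar F (a * ∑ k, algebraMap (ZMod 3) F (u k) * f k)) := by
    intro a
    have h1 := hprod (1 + X) 1 fun k => Algebra.trace (ZMod 3) F (a * f k)
    rw [one_pow, mul_one] at h1
    rw [traceWeight, ← h1]
    simp only [hfour]
    rw [Finset.prod_univ_sum, Fintype.piFinset_univ]
    refine sum_congr rfl fun u _ => ?_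
    rw [prod_mul_distrib, hprod, ← map_prod C]
    congr 2
    rw [canonicalChar_apply, mul_sum, map_sum,
      addChar_map_sum (ZMod.stdAddChar (N := 3))]
    refine prod_congr rfl fun k _ => ?_
    rw [mul_left_comm, ← Algebra.smul_def, map_smul, smul_eq_mul]
  simp only [hexp]
  rw [sum_comm]
  simp only [← mul_sum, ← map_sum C, sum_canonicalChar_mul]
  have hcollect : ∀ G : ℕ → ℂ[X],
      ∑ u : Fin N → ZMod 3, G (hammingNorm u) *
        C (if ∑ k, algebraMap (ZMod 3) F (u k) * f k = 0 then (Fintype.card F : ℂ) else 0)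
      = C (Fintype.card F : ℂ) *
        ∑ j ∈ range (N + 1), (weightCount (orthogonalCode f) j : ℂ[X]) * G j := by
    intro G
    have h1 : ∀ u : Fin N → ZMod 3, G (hammingNorm u) *
        C (if ∑ k, algebraMap (ZMod 3) F (u k) * f k = 0 then (Fintype.card F : ℂ) else 0)
        = if u ∈ orthogonalCode f then C (Fintype.card F : ℂ) * G (hammingNorm u) else 0 := by
      intro u
      simp only [mem_orthogonalCode]
      split_ifs
      · rw [mul_comm]
      · simp
    rw [sum_congr rfl fun u _ => h1 u, ← sum_filter, mul_sum,
      ← sum_fiberwise_of_maps_to (g := fun u => hammingNorm u) (t := range (N + 1))]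
    · refine sum_congr rfl fun j _ => ?_
      rw [sum_congr rfl (g := fun _ => C (Fintype.card F : ℂ) * G j), sum_const, filter_filter,
        weightCount, Nat.card_eq_fintype_card, Fintype.card_subtype, nsmul_eq_mul]
      · ring
      · intro u hu
        rw [(mem_filter.1 hu).2]
    · intro u _
      have := hammingNorm_le_card_fintype (x := u)
      rw [Fintype.card_fin] at this
      exact mem_range.2 (by omega)
  exact hcollect fun j => (C (-1 / 3 : ℂ) * X) ^ j * (1 + C (2 / 3 : ℂ) * X) ^ (N - j)

/-- Comparison of the coefficients of `X ^ t` in the MacWilliams identity. -/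
theorem sum_choose_traceWeight {N : ℕ} (f : Fin N → F) (t : ℕ) :
    ∑ a : F, ((traceWeight f a).choose t : ℂ) =
      (Fintype.card F : ℂ) * ∑ j ∈ range (N + 1), if j ≤ t then
        (-1) ^ j * (weightCount (orthogonalCode f) j : ℂ) * (2 : ℂ) ^ (t - j) / 3 ^ t *
          (chooseSub N j t : ℂ) else 0 := by
  have h := congrArg (fun p => coeff p t) (sum_one_add_X_pow_traceWeight f)
  simp only [finsetSum_coeff, coeff_one_add_X_pow, coeff_C_mul] at h
  rw [h]
  congr 1
  refine sum_congr rfl fun j hj => ?_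
  have hjN : j ≤ N := Nat.lt_succ_iff.1 (mem_range.1 hj)
  have h1 : ((1 : ℂ[X]) + C (2 / 3 : ℂ) * X) ^ (N - j)
      = ((1 + X) ^ (N - j) : ℂ[X]).comp (C (2 / 3 : ℂ) * X) := by simp
  rw [h1, mul_pow, ← C_pow, ← C_eq_natCast, coeff_C_mul, mul_assoc, coeff_C_mul, coeff_X_pow_mul']
  split_ifs with hjt
  · rw [comp_C_mul_X_coeff, coeff_one_add_X_pow, choose_sub_eq_chooseSub hjN hjt]
    obtain ⟨d, rfl⟩ := Nat.exists_eq_add_of_le hjt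
    rw [Nat.add_sub_cancel_left, div_pow, div_pow, pow_add]
    field_simp
  · simp

/-- The power moment (Pless) identity: `w ^ h` is a combination of the binomial coefficients
`w.choose t` with Stirling numbers as coefficients, and their sums are `sum_choose_traceWeight`. -/
theorem sum_traceWeight_pow {N : ℕ} (f : Fin N → F) (h : ℕ) :
    ∑ a : F, (traceWeight f a : ℂ) ^ h =
      (Fintype.card F : ℂ) * ∑ j ∈ range (min N h + 1),
        (-1) ^ j * (weightCount (orthogonalCode f) j : ℂ) * ∑ t ∈ Icc j h,
          (t.factorial : ℂ) * (Nat.stirlingSecond h t : ℂ) * (2 : ℂ) ^ (t - j) / 3 ^ t *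
            (chooseSub N j t : ℂ) := by
  have h1 : ∀ a : F, (traceWeight f a : ℂ) ^ h = ∑ t ∈ range (h + 1),
      (t.factorial : ℂ) * (Nat.stirlingSecond h t : ℂ) * ((traceWeight f a).choose t : ℂ) := by
    intro a
    exact_mod_cast pow_eq_sum_stirlingSecond (traceWeight f a) h
  simp only [h1]
  rw [sum_comm]
  simp only [← mul_sum, sum_choose_traceWeight]
  simp only [mul_left_comm _ (Fintype.card F : ℂ)]
  rw [← mul_sum]
  congr 1
  simp only [mul_sum]
  rw [sum_comm]
  refine (sum_subset_zero_on_sdiff (range_subset_range.2 (by omega)) ?_ ?_).symm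
  · intro j hj
    refine sum_eq_zero fun t ht => ?_
    simp only [mem_sdiff, mem_range] at hj ht
    rw [if_neg (by omega), mul_zero]
  · intro j hj
    refine sum_subset_zero_on_sdiff (fun t ht => ?_) (fun t ht => ?_) (fun t ht => ?_)
    · simp only [mem_Icc, mem_range] at ht ⊢
      omega
    · simp only [mem_Icc, mem_range, mem_sdiff] at ht
      rw [if_neg (by omega), mul_zero]
    · rw [if_pos (mem_Icc.1 ht).1]
      ring

/-- The weight of a dual word in terms of exponential sums, by `1_{x ≠ 0} = (2 - ω ^ x - ω ^ (-x)) / 3`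
on `𝔽₃`, where `ω` is a primitive cube root of unity. -/
theorem traceWeight_eq {N : ℕ} (f : Fin N → F) (a : F) :
    (traceWeight f a : ℂ) = (2 * (N : ℂ) - ∑ k, canonicalChar F (a * f k)
      - ∑ k, canonicalChar F (-a * f k)) / 3 := by
  have h1 : (traceWeight f a : ℂ)
      = ∑ k, if Algebra.trace (ZMod 3) F (a * f k) ≠ 0 then (1 : ℂ) else 0 := by
    rw [traceWeight, hammingNorm, card_filter]
    push_cast
    rfl
  have h2 : ∀ k, (if Algebra.trace (ZMod 3) F (a * f k) ≠ 0 then (1 : ℂ) else 0)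
      = (2 - canonicalChar F (a * f k) - canonicalChar F (-a * f k)) / 3 := by
    intro k
    have h3 := sum_stdAddChar_three (Algebra.trace (ZMod 3) F (a * f k))
    have h4 : ∀ G : ZMod 3 → ℂ, ∑ s, G s = G 0 + G 1 + G (-1) := fun G => by
      exact Fin.sum_univ_three G
    rw [h4, zero_mul, one_mul, neg_one_mul, AddChar.map_zero_eq_one, ← map_neg, ← neg_mul,
      ← canonicalChar_apply, ← canonicalChar_apply] at h3
    split_ifs with h5
    · rw [if_neg h5] at h3
      linear_combination (1 / 3) * h3
    · rw [if_pos (not_not.1 h5)] at h3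
      linear_combination (1 / 3) * h3
  rw [h1, sum_congr rfl fun k _ => h2 k, ← sum_div, sum_sub_distrib, sum_sub_distrib]
  simp [mul_comm]

open Classical in
theorem sum_units_sq (T : Fˣ → ℂ) :
    ∑ a : Fˣ, T (a ^ 2) = 2 * ∑ b : Fˣ with IsSquare b, T b := by
  have hne : ∀ c : Fˣ, c ≠ -c := fun c h => ne_neg_self c.ne_zero (congrArg Units.val h)
  rw [← sum_fiberwise_of_maps_to (g := fun a : Fˣ => a ^ 2) (t := {b | IsSquare b})
    (fun a _ => mem_filter.2 ⟨mem_univ _, IsSquare.sq a⟩), mul_sum]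
  refine sum_congr rfl fun b hb => ?_
  obtain ⟨c, rfl⟩ := (mem_filter.1 hb).2
  have h1 : ({a : Fˣ | a ^ 2 = c * c} : Finset Fˣ) = {c, -c} := by
    ext a
    simp only [mem_filter, mem_univ, true_and, mem_insert, mem_singleton, ← sq, Units.ext_iff,
      Units.val_pow_eq_pow_val, Units.val_neg]
    exact sq_eq_sq_iff_eq_or_eq_neg
  rw [h1, sum_pair (hne c), neg_sq, ← sq]
  ring

open Classical in
/-- If the exponential sums of `f` at `a ≠ 0` are, up to an affine change, the values `T (a ^ 2)`,
then the weights of the dual words are `(2 κ / 3) (M - T (a ^ 2))`. Expanding `(M - T b) ^ h`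
binomially in the power moment identity and solving for the term with `j = h` gives a recursion for
the power moments of `T` over the squares. -/
theorem moment_recursion {N : ℕ} (f : Fin N → F) (κ M : ℂ) (hκ : κ ≠ 0) (T : Fˣ → ℂ)
    (hT : ∀ a : Fˣ, (N : ℂ) - ∑ k, canonicalChar F (a * f k) = κ * (M - T (a ^ 2)))
    {h : ℕ} (hh : 1 ≤ h) :
    ∑ b : Fˣ with IsSquare b, T b ^ h =
      ∑ j ∈ range h, (-1 : ℂ) ^ (h + j + 1) * (h.choose j : ℂ) * M ^ (h - j) *
        (∑ b : Fˣ with IsSquare b, T b ^ j)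
      + (Fintype.card F : ℂ) * (κ ^ h)⁻¹ * ∑ j ∈ range (min N h + 1),
          (-1 : ℂ) ^ (h + j) * (weightCount (orthogonalCode f) j : ℂ) * ∑ t ∈ Icc j h,
            (t.factorial : ℂ) * (Nat.stirlingSecond h t : ℂ) * 3 ^ (h - t) *
              (2 : ℂ) ^ ((t : ℤ) - h - j - 1) * (chooseSub N j t : ℂ) := by
  have hw : ∀ a : Fˣ, (traceWeight f a : ℂ) = 2 * κ / 3 * (M - T (a ^ 2)) := by
    intro a
    have h1 := hT a
    have h2 := hT (-a)
    rw [neg_sq, Units.val_neg] at h2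
    rw [traceWeight_eq]
    linear_combination (1 / 3) * h1 + (1 / 3) * h2
  -- the word with `a = 0` has weight zero, so it contributes nothing as `h ≥ 1`
  have hw0 : traceWeight f 0 = 0 := by simp [traceWeight, hammingNorm]
  have hsum : ∑ a : F, (traceWeight f a : ℂ) ^ h
      = 2 * (2 * κ / 3) ^ h * ∑ b : Fˣ with IsSquare b, (M - T b) ^ h := by
    have h1 : ∑ a : F, (traceWeight f a : ℂ) ^ h = ∑ a : Fˣ, (traceWeight f a : ℂ) ^ h := by
      rw [← Fintype.sum_subtype_add_sum_subtype (fun a : F => a ≠ 0)]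
      have h2 : ∑ i : {x : F // ¬ x ≠ 0}, (traceWeight f i : ℂ) ^ h = 0 :=
        sum_eq_zero fun i _ => by
          rw [not_not.1 i.2, hw0, Nat.cast_zero, zero_pow (by omega)]
      rw [h2, add_zero]
      exact (Fintype.sum_equiv unitsEquivNeZero _ _ fun a => rfl).symm
    rw [h1, sum_congr rfl fun a _ => by rw [hw a],
      sum_units_sq fun b => (2 * κ / 3 * (M - T b)) ^ h, mul_assoc, mul_sum _ _ ((2 * κ / 3) ^ h)]
    exact congrArg _ (sum_congr rfl fun b _ => mul_pow _ _ _)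
  have hbin : ∑ b : Fˣ with IsSquare b, (M - T b) ^ h
      = (-1) ^ h * ∑ b : Fˣ with IsSquare b, T b ^ h + ∑ j ∈ range h, (-1 : ℂ) ^ j *
          (h.choose j : ℂ) * M ^ (h - j) * (∑ b : Fˣ with IsSquare b, T b ^ j) := by
    have h1 : ∀ b : Fˣ, (M - T b) ^ h
        = ∑ j ∈ range (h + 1), (-1 : ℂ) ^ j * (h.choose j : ℂ) * M ^ (h - j) * T b ^ j := by
      intro b
      rw [sub_eq_neg_add, add_pow]
      refine sum_congr rfl fun j _ => ?_
      rw [neg_pow]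
      ring
    simp only [h1]
    rw [sum_comm, sum_range_succ, add_comm]
    simp [mul_sum]
  have hpow := sum_traceWeight_pow f h
  rw [hsum, hbin] at hpow
  have hsq : ((-1 : ℂ) ^ h) * (-1) ^ h = 1 := by rw [← mul_pow]; norm_num
  have hR : (Fintype.card F : ℂ) * (κ ^ h)⁻¹ * ∑ j ∈ range (min N h + 1),
          (-1 : ℂ) ^ (h + j) * (weightCount (orthogonalCode f) j : ℂ) * ∑ t ∈ Icc j h,
            (t.factorial : ℂ) * (Nat.stirlingSecond h t : ℂ) * 3 ^ (h - t) *
              (2 : ℂ) ^ ((t : ℤ) - h - j - 1) * (chooseSub N j t : ℂ)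
      = (-1) ^ h * (2 * (2 * κ / 3) ^ h)⁻¹ * ((Fintype.card F : ℂ) * ∑ j ∈ range (min N h + 1),
        (-1) ^ j * (weightCount (orthogonalCode f) j : ℂ) * ∑ t ∈ Icc j h,
          (t.factorial : ℂ) * (Nat.stirlingSecond h t : ℂ) * (2 : ℂ) ^ (t - j) / 3 ^ t *
            (chooseSub N j t : ℂ)) := by
    simp only [mul_sum]
    refine sum_congr rfl fun j _ => sum_congr rfl fun t ht => ?_
    obtain ⟨hjt, hth⟩ := mem_Icc.1 ht
    have h2 : (2 : ℂ) ^ ((t : ℤ) - h - j - 1) = 2 ^ (t - j) / (2 * 2 ^ h) := by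
      rw [show (t : ℤ) - h - j - 1 = ((t - j : ℕ) : ℤ) - ((h + 1 : ℕ) : ℤ) by push_cast [hjt]; ring,
        zpow_sub₀ two_ne_zero, zpow_natCast, zpow_natCast, pow_succ']
    have h3 : (3 : ℂ) ^ (h - t) = 3 ^ h / 3 ^ t := by
      rw [pow_sub₀ _ three_ne_zero hth, div_eq_mul_inv]
    rw [h2, h3, div_pow, mul_pow, pow_add]
    field_simp
  have hne : (2 * (2 * κ / 3) ^ h : ℂ) ≠ 0 :=
    mul_ne_zero two_ne_zero (pow_ne_zero _ (div_ne_zero (mul_ne_zero two_ne_zero hκ) three_ne_zero))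
  have hS : ∑ j ∈ range h, (-1 : ℂ) ^ (h + j + 1) * (h.choose j : ℂ) * M ^ (h - j) *
        (∑ b : Fˣ with IsSquare b, T b ^ j)
      = -((-1) ^ h * ∑ j ∈ range h, (-1 : ℂ) ^ j *
          (h.choose j : ℂ) * M ^ (h - j) * (∑ b : Fˣ with IsSquare b, T b ^ j)) := by
    rw [mul_sum, ← sum_neg_distrib]
    exact sum_congr rfl fun j _ => by ring
  rw [hR, ← hpow, hS, mul_assoc, inv_mul_cancel_left₀ hne]
  linear_combination (-∑ b : Fˣ with IsSquare b, T b ^ h) * hsq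

end Character

end

/-! ### The weight enumerator from the value distribution -/

section

open Finset

theorem choose_mul_choose_eq_trinomial (n a b : ℕ) :
    n.choose a * (n - a).choose b = trinomial n a b := by
  unfold trinomial
  split_ifs with h
  · have h1 := Nat.choose_mul_factorial_mul_factorial (show a ≤ n by omega)
    have h2 := Nat.choose_mul_factorial_mul_factorial (show b ≤ n - a by omega)
    refine (Nat.div_eq_of_eq_mul_left (by positivity) ?_).symm
    rw [← h1, ← h2]
    ring
  · rcases lt_or_ge n a with h1 | h1
    · rw [Nat.choose_eq_zero_of_lt h1, zero_mul]
    · rw [Nat.choose_eq_zero_of_lt (show n - a < b by omega), mul_zero]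

/-- The number of ternary vectors with `a` entries `1` and `b` entries `-1`. -/
theorem card_filter_eq_trinomial {ι : Type*} [Fintype ι] [DecidableEq ι] (a b : ℕ) :
    #{u : ι → ZMod 3 | #{k | u k = 1} = a ∧ #{k | u k = -1} = b}
      = trinomial (Fintype.card ι) a b := by
  have h01 : (0 : ZMod 3) ≠ 1 := by decide
  have h02 : (0 : ZMod 3) ≠ -1 := by decide
  have h12 : (1 : ZMod 3) ≠ -1 := by decide
  have hd : ∀ A B : Finset ι, B ⊆ Aᶜ →
      ({k | (if k ∈ A then 1 else if k ∈ B then -1 else 0 : ZMod 3) = 1} : Finset ι) = A ∧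
      ({k | (if k ∈ A then 1 else if k ∈ B then -1 else 0 : ZMod 3) = -1} : Finset ι) = B := by
    intro A B hB
    constructor
    · ext k
      by_cases h1 : k ∈ A <;> by_cases h2 : k ∈ B <;> simp [h1, h2, h01, h12.symm]
    · ext k
      by_cases h1 : k ∈ A
      · have h2 : k ∉ B := fun h => mem_compl.1 (hB h) h1
        simp [h1, h2, h12]
      · by_cases h2 : k ∈ B <;> simp [h1, h2, h02]
  have hc : #((powersetCard a (univ : Finset ι)).sigma fun A => powersetCard b Aᶜ)
      = trinomial (Fintype.card ι) a b := by
    rw [card_sigma, sum_congr rfl (g := fun _ => (Fintype.card ι - a).choose b), sum_const,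
      card_powersetCard, card_univ, smul_eq_mul, choose_mul_choose_eq_trinomial]
    intro A hA
    rw [card_powersetCard, card_compl, (mem_powersetCard.1 hA).2]
  rw [← hc]
  refine card_nbij'
    (fun u => ⟨univ.filter fun k => u k = 1, univ.filter fun k => u k = -1⟩)
    (fun s k => if k ∈ s.1 then 1 else if k ∈ s.2 then -1 else 0) ?_ ?_ ?_ ?_
  · intro u hu
    simp only [coe_filter, mem_univ, true_and, Set.mem_ofPred_eq] at hu
    simp only [coe_sigma, Set.mem_sigma_iff, mem_coe, mem_powersetCard, subset_univ, true_and]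
    refine ⟨hu.1, fun k hk => ?_, hu.2⟩
    simp only [mem_filter, mem_univ, true_and, mem_compl] at hk ⊢
    rw [hk]
    exact h12.symm
  · rintro ⟨A, B⟩ hs
    simp only [coe_sigma, Set.mem_sigma_iff, mem_coe, mem_powersetCard, subset_univ, true_and] at hs
    obtain ⟨hA, hB, hb⟩ := hs
    obtain ⟨h1, h2⟩ := hd A B hB
    simp only [coe_filter, mem_univ, true_and, Set.mem_ofPred_eq, h1, h2]
    exact ⟨hA, hb⟩
  · intro u _
    funext k
    have : ∀ x : ZMod 3, (if x = 1 then 1 else if x = -1 then -1 else 0) = x := by decide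
    simpa using this (u k)
  · rintro ⟨A, B⟩ hs
    simp only [coe_sigma, Set.mem_sigma_iff, mem_coe, mem_powersetCard, subset_univ, true_and] at hs
    obtain ⟨hA, hB, hb⟩ := hs
    obtain ⟨h1, h2⟩ := hd A B hB
    simp only [h1, h2]

/-- Splitting a function on `ι` into its restrictions to the fibres of `f`. -/
def fiberFunctionEquiv {ι κ : Type*} (α : Type*) (f : ι → κ) :
    (ι → α) ≃ ((b : κ) → {k // f k = b} → α) where
  toFun u _ k := u k
  invFun v k := v (f k) ⟨k, rfl⟩
  left_inv _ := rfl
  right_inv v := by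
    funext b ⟨k, hk⟩
    subst hk
    rfl

/-- The number of ternary vectors whose numbers of entries `±1` on the fibres of `f` are
prescribed. -/
theorem card_filter_fiberwise {ι κ : Type*} [Fintype ι] [DecidableEq ι] [Fintype κ] [DecidableEq κ]
    (f : ι → κ) (ν μ : κ → ℕ) :
    #{u : ι → ZMod 3 | (∀ b, #{k | f k = b ∧ u k = 1} = ν b) ∧ ∀ b, #{k | f k = b ∧ u k = -1} = μ b}
      = ∏ b, trinomial #{k | f k = b} (ν b) (μ b) := by
  have hsub : ∀ (u : ι → ZMod 3) (b : κ) (s : ZMod 3),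
      #{k | f k = b ∧ u k = s} = #{k : {k // f k = b} | u k = s} := by
    intro u b s
    rw [← filter_filter, ← card_map (Function.Embedding.subtype fun k => f k = b)]
    congr 1
    ext k
    simp [and_comm]
  calc _ = #(Fintype.piFinset fun b => ({v : {k // f k = b} → ZMod 3 |
        #{k | v k = 1} = ν b ∧ #{k | v k = -1} = μ b} : Finset _)) := by
        refine card_equiv (fiberFunctionEquiv (ZMod 3) f) fun u => ?_
        simp only [mem_filter, mem_univ, true_and, Fintype.mem_piFinset, hsub, ← forall_and]
        rfl
    _ = _ := by
        rw [Fintype.card_piFinset]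
        refine prod_congr rfl fun b _ => ?_
        rw [card_filter_eq_trinomial, Fintype.card_subtype]

/-- The weight enumerator of the code orthogonal to `f`, in terms of the value distribution
of `f`. -/
theorem weightCount_orthogonalCode {F : Type*} [Field F] [Fintype F] [DecidableEq F]
    [Algebra (ZMod 3) F] {N : ℕ} (f : Fin N → F) (j : ℕ) :
    weightCount (orthogonalCode f) j =
      ∑ p ∈ indexSet F j, ∏ β, trinomial #{k | f k = β} (p.1 β) (p.2 β) := by
  classical
  let φ : (Fin N → ZMod 3) → (F → ℕ) × (F → ℕ) := fun u =>
    (fun β => #{k | f k = β ∧ u k = 1}, fun β => #{k | f k = β ∧ u k = -1})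
  have hwt : ∀ u, hammingNorm u = ∑ β, (φ u).1 β + ∑ β, (φ u).2 β := by
    intro u
    have h1 : ∀ s : ZMod 3, ∑ β, #{k | f k = β ∧ u k = s} = #{k | u k = s} := by
      intro s
      rw [card_eq_sum_card_fiberwise (f := f) (t := univ) (fun _ _ => mem_univ _)]
      simp only [filter_filter, and_comm]
    have h2 : ∀ x : ZMod 3, (if x ≠ 0 then 1 else 0 : ℕ)
        = (if x = 1 then 1 else 0) + if x = -1 then 1 else 0 := by decide
    simp only [φ]
    rw [h1, h1, hammingNorm, card_filter, card_filter, card_filter, ← sum_add_distrib]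
    exact sum_congr rfl fun k _ => h2 (u k)
  have hlin : ∀ u, ∑ k, algebraMap (ZMod 3) F (u k) * f k
      = ∑ β, ((φ u).1 β : F) * β - ∑ β, ((φ u).2 β : F) * β := by
    intro u
    have h2 : ∀ x : ZMod 3, algebraMap (ZMod 3) F x
        = (if x = 1 then 1 else 0) - if x = -1 then 1 else 0 := by
      intro x
      have h3 : x = (if x = 1 then 1 else 0) - if x = -1 then 1 else 0 := by
        revert x; decide
      conv_lhs => rw [h3]
      rw [map_sub, apply_ite (algebraMap (ZMod 3) F), apply_ite (algebraMap (ZMod 3) F), map_one,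
        map_zero]
    rw [← sum_sub_distrib, ← sum_fiberwise (s := univ) (g := f)]
    refine sum_congr rfl fun β _ => ?_
    rw [← sub_mul, sum_congr rfl (g := fun k => algebraMap (ZMod 3) F (u k) * β)
      (fun k hk => by rw [(mem_filter.1 hk).2]), ← sum_mul]
    congr 1
    simp only [h2, φ, sum_sub_distrib, sum_boole, filter_filter]
  have hmem : ∀ u, (u ∈ orthogonalCode f ∧ hammingNorm u = j) ↔ φ u ∈ indexSet F j := by
    intro u
    rw [mem_indexSet, mem_orthogonalCode, hlin, hwt, sub_eq_zero, and_comm]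
  rw [weightCount, Nat.card_eq_fintype_card, Fintype.card_subtype,
    card_eq_sum_card_fiberwise (f := φ) (t := indexSet F j)
      (fun u hu => (hmem u).1 (mem_filter.1 hu).2)]
  refine sum_congr rfl fun p hp => ?_
  rw [← card_filter_fiberwise f p.1 p.2, filter_filter]
  congr 1
  refine filter_congr fun u _ => ?_
  rw [hmem]
  constructor
  · rintro ⟨-, rfl⟩
    exact ⟨fun _ => rfl, fun _ => rfl⟩
  · rintro ⟨h1, h2⟩
    have h3 : φ u = p := Prod.ext (funext h1) (funext h2)
    exact ⟨h3 ▸ hp, h3⟩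

end

/-! ### Traces in `Sp(2, F)` -/

section

open Finset

theorem card_filter_prod {α β : Type*} [Fintype α] [Fintype β] (P : α × β → Prop)
    [DecidablePred P] :
    #{p : α × β | P p} = ∑ a, #{b | P (a, b)} := by
  simp only [card_filter, Fintype.sum_prod_type]

section

variable {F : Type*} [Field F]

/-- The number of ways of writing `β` as `α + α⁻¹` with `α ≠ 0`. -/
noncomputable def delta1 (β : F) : ℕ := Nat.card {α : Fˣ // (α : F) + (α : F)⁻¹ = β}

theorem mem_Sp_one_iff (w : Matrix (Fin 1 ⊕ Fin 1) (Fin 1 ⊕ Fin 1) F) :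
    w ∈ Sp 1 F ↔ w (.inl 0) (.inl 0) * w (.inr 0) (.inr 0)
      - w (.inl 0) (.inr 0) * w (.inr 0) (.inl 0) = 1 := by
  rw [SymplecticGroup.mem_iff]
  constructor
  · intro h
    have h1 := congrFun (congrFun h (.inr 0)) (.inl 0)
    simp [Matrix.mul_apply, Matrix.J] at h1
    linear_combination h1
  · intro h
    ext i j
    rcases i with i | i <;> rcases j with j | j <;> fin_cases i <;> fin_cases j <;>
      simp [Matrix.mul_apply, Matrix.J]
    · ring
    · linear_combination -h
    · linear_combination h
    · ring

/-- Elements of `Sp(2, F)` with trace `β`, parametrized by three matrix entries. -/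
def traceOneEquiv (β : F) :
    {w : Sp 1 F // (w : Matrix (Fin 1 ⊕ Fin 1) (Fin 1 ⊕ Fin 1) F).trace = β} ≃
      {p : F × F × F // p.2.1 * p.2.2 = p.1 * (β - p.1) - 1} where
  toFun w := ⟨(w.1.1 (.inl 0) (.inl 0), w.1.1 (.inl 0) (.inr 0), w.1.1 (.inr 0) (.inl 0)), by
    obtain ⟨⟨w, hw⟩, rfl⟩ := w
    rw [mem_Sp_one_iff] at hw
    simp only [Matrix.trace, Matrix.diag_apply, Fintype.sum_sum_type, Fin.sum_univ_one]
    linear_combination -hw⟩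
  invFun p := ⟨⟨Matrix.fromBlocks !![p.1.1] !![p.1.2.1] !![p.1.2.2]
      !![β - p.1.1], by
    rw [mem_Sp_one_iff]
    have := p.2
    simp only [Matrix.fromBlocks_apply₁₁, Matrix.fromBlocks_apply₁₂, Matrix.fromBlocks_apply₂₁,
      Matrix.fromBlocks_apply₂₂, Matrix.of_apply, Matrix.cons_val_zero]
    linear_combination -this⟩, by
    simp [Matrix.trace]⟩
  left_inv w := by
    obtain ⟨⟨w, hw⟩, rfl⟩ := w
    apply Subtype.ext
    apply Subtype.ext
    ext i j
    rcases i with i | i <;> rcases j with j | j <;> fin_cases i <;> fin_cases j <;>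
      simp [Matrix.trace]
  right_inv p := rfl

variable [Fintype F]

open Classical in
theorem card_mul_eq (t : F) :
    #{p : F × F | p.1 * p.2 = t} =
      (Fintype.card F - 1) + if t = 0 then Fintype.card F else 0 := by
  rw [card_filter_prod, ← add_sum_erase univ _ (mem_univ (0 : F)), add_comm]
  congr 1
  · rw [sum_congr rfl (g := fun _ => 1), sum_const, card_erase_of_mem (mem_univ _), card_univ,
      smul_eq_mul, mul_one]
    intro a ha
    rw [card_eq_one]
    refine ⟨a⁻¹ * t, ?_⟩
    ext b
    simp only [mem_filter, mem_univ, true_and, mem_singleton]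
    rw [eq_inv_mul_iff_mul_eq₀ (ne_of_mem_erase ha)]
  · simp only [zero_mul, eq_comm (a := (0 : F))]
    split_ifs <;> simp_all

/-- For a given upper left entry `a` the other three entries solve `b c = a (β - a) - 1`, which has
`q - 1` solutions, and `q` more if the right-hand side vanishes, that is, if `a + a⁻¹ = β`. -/
theorem traceCount_one_eq (β : F) :
    traceCount 1 F β =
      Fintype.card F * (Fintype.card F - 1) + Fintype.card F * delta1 β := by
  classical
  rw [traceCount, Nat.card_congr (traceOneEquiv β), Nat.card_eq_fintype_card, Fintype.card_subtype,
    card_filter_prod]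
  have h1 : ∀ a : F, #{b : F × F | b.1 * b.2 = a * (β - a) - 1} = _ := fun a => card_mul_eq _
  rw [sum_congr rfl fun a _ => h1 a, sum_add_distrib, sum_const, card_univ, smul_eq_mul,
    ← sum_filter, sum_const, smul_eq_mul, mul_comm _ (Fintype.card F)]
  congr 2
  rw [delta1, Nat.card_eq_fintype_card, Fintype.card_subtype]
  symm
  refine card_bij (fun α _ => (α : F)) ?_ ?_ ?_
  · intro α hα
    have h := (mem_filter.1 hα).2
    refine mem_filter.2 ⟨mem_univ _, ?_⟩
    rw [← h, add_sub_cancel_left, mul_inv_cancel₀ α.ne_zero, sub_self]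
  · intro α _ γ _ h
    exact Units.ext h
  · intro a ha
    have h := (mem_filter.1 ha).2
    refine ⟨Units.mkOfMulEqOne a (β - a) (by linear_combination h), mem_filter.2 ⟨mem_univ _, ?_⟩,
      rfl⟩
    rw [← Units.val_inv_eq_inv_val]
    exact add_sub_cancel a β

theorem sum_delta1 : ∑ β : F, delta1 β = Fintype.card F - 1 := by
  classical
  simp only [delta1, Nat.card_eq_fintype_card, Fintype.card_subtype]
  rw [← card_eq_sum_card_fiberwise (f := fun α : Fˣ => (α : F) + (α : F)⁻¹)
    (fun _ _ => mem_univ _), card_univ, Fintype.card_units]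

theorem sum_traceCount (n : ℕ) : ∑ β : F, traceCount n F β = Nat.card (Sp n F) := by
  classical
  rw [Nat.card_eq_fintype_card, ← card_univ, card_eq_sum_card_fiberwise (t := univ)
    (f := fun w : Sp n F => (w : Matrix (Fin n ⊕ Fin n) (Fin n ⊕ Fin n) F).trace)
    (fun _ _ => mem_univ _)]
  exact sum_congr rfl fun β _ => by
    rw [traceCount, Nat.card_eq_fintype_card, Fintype.card_subtype]

theorem card_Sp_one :
    Nat.card (Sp 1 F) = Fintype.card F * (Fintype.card F ^ 2 - 1) := by
  have hq : 1 ≤ Fintype.card F := Fintype.card_pos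
  rw [← sum_traceCount]
  simp only [traceCount_one_eq]
  rw [sum_add_distrib, sum_const, ← mul_sum, sum_delta1, card_univ, smul_eq_mul]
  have hq2 : 1 ≤ Fintype.card F ^ 2 := Nat.one_le_pow _ _ hq
  zify [hq, hq2]
  ring

end

section

variable {F : Type*} [Field F] [Algebra (ZMod 3) F]

variable [Fintype F]

open Classical in
theorem delta1_eq (β : F) :
    delta1 β = if β = 1 ∨ β = -1 then 1 else if IsSquare (β ^ 2 - 1) then 2 else 0 := by
  -- completing the square: in characteristic three `a² - β a + 1 = (a + β)² - (β² - 1)`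
  have h1 : delta1 β = #{s : F | s ^ 2 = β ^ 2 - 1} := by
    rw [delta1, Nat.card_eq_fintype_card, Fintype.card_subtype]
    refine card_bij (fun α _ => (α : F) + β) ?_ ?_ ?_
    · intro α hα
      have h := (mem_filter.1 hα).2
      refine mem_filter.2 ⟨mem_univ _, ?_⟩
      have h2 : (α : F) * (α : F)⁻¹ = 1 := mul_inv_cancel₀ α.ne_zero
      linear_combination (α : F) * h - h2 + (α : F) * β * three_eq_zero (F := F)
    · intro α _ γ _ h
      exact Units.ext (add_right_cancel h)
    · intro s hs
      have h := (mem_filter.1 hs).2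
      have h2 : (s - β) * (β - (s - β)) = 1 := by
        linear_combination -h + (s * β - β ^ 2) * three_eq_zero (F := F)
      refine ⟨Units.mkOfMulEqOne _ _ h2, mem_filter.2 ⟨mem_univ _, ?_⟩, sub_add_cancel s β⟩
      rw [← Units.val_inv_eq_inv_val]
      exact add_sub_cancel (s - β) β
  have h2 : (β = 1 ∨ β = -1) ↔ β ^ 2 - 1 = 0 := by
    rw [sub_eq_zero, sq, mul_self_eq_one_iff]
  rw [h1]
  split_ifs with h3 h4
  · rw [h2.1 h3, card_eq_one]
    exact ⟨0, by ext; simp⟩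
  · obtain ⟨c, hc⟩ := h4
    have hc0 : c ≠ 0 := by
      rintro rfl
      exact h3 (h2.2 (by rw [hc, mul_zero]))
    rw [hc]
    refine (congrArg card (Finset.ext fun s => ?_)).trans (card_pair (ne_neg_self hc0))
    simp [← sq, sq_eq_sq_iff_eq_or_eq_neg]
  · rw [card_eq_zero, filter_eq_empty_iff]
    intro s _ hs
    exact h4 ⟨s, by rw [← hs, sq]⟩

open Classical in
theorem traceCount_one (β : F) :
    traceCount 1 F β =
      if β = 1 ∨ β = -1 then Fintype.card F ^ 2
      else if IsSquare (β ^ 2 - 1) then Fintype.card F ^ 2 + Fintype.card F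
      else Fintype.card F ^ 2 - Fintype.card F := by
  have hq : 1 ≤ Fintype.card F := Fintype.card_pos
  have hq2 : Fintype.card F ≤ Fintype.card F ^ 2 := Nat.le_self_pow two_ne_zero _
  rw [traceCount_one_eq, delta1_eq]
  split_ifs <;> zify [hq, hq2] <;> ring

open Classical in
/-- The substitution `α ↦ a α` in the Kloosterman sum. -/
theorem kloosterman_sq (a : Fˣ) :
    kloosterman (canonicalChar F) (a ^ 2) =
      ∑ α : Fˣ, canonicalChar F (a * ((α : F) + (α : F)⁻¹)) := by
  unfold kloosterman
  refine (Fintype.sum_equiv (Equiv.mulLeft a) _ _ fun α => ?_).symm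
  have h1 : (a : F) ≠ 0 := a.ne_zero
  have h2 : (α : F) ≠ 0 := α.ne_zero
  congr 1
  simp only [Equiv.coe_mulLeft, Units.val_mul, Units.val_pow_eq_pow_val]
  field_simp

/-- Grouping a sum over a finite type by the values of a function. -/
theorem sum_canonicalChar_eq_sum_card {ι : Type*} [Fintype ι] (f : ι → F) (a : F) :
    ∑ k, canonicalChar F (a * f k) =
      ∑ β, (Nat.card {k // f k = β} : ℂ) * canonicalChar F (a * β) := by
  classical
  rw [← sum_fiberwise (s := univ) (g := f)]
  refine sum_congr rfl fun β _ => ?_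
  rw [Nat.card_eq_fintype_card, Fintype.card_subtype, ← nsmul_eq_mul, ← sum_const]
  exact sum_congr rfl fun k hk => by rw [(mem_filter.1 hk).2]

theorem sum_delta1_mul_canonicalChar (a : Fˣ) :
    ∑ β : F, (delta1 β : ℂ) * canonicalChar F (a * β) = kloosterman (canonicalChar F) (a ^ 2) := by
  classical
  rw [kloosterman_sq, sum_canonicalChar_eq_sum_card]
  rfl

theorem sum_delta2_mul_canonicalChar (a : Fˣ) :
    ∑ β : F, (delta2 β : ℂ) * canonicalChar F (a * β) =
      kloosterman (canonicalChar F) (a ^ 2) ^ 2 := by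
  classical
  have h := sum_canonicalChar_eq_sum_card (fun p : Fˣ × Fˣ =>
    (p.1 : F) + (p.1 : F)⁻¹ + (p.2 : F) + (p.2 : F)⁻¹) a
  rw [kloosterman_sq, sq, Fintype.sum_mul_sum, ← Fintype.sum_prod_type']
  unfold delta2
  rw [← h]
  refine sum_congr rfl fun p _ => ?_
  rw [← AddChar.map_add_eq_mul]
  congr 1
  ring

theorem sum_canonicalChar_unit (a : Fˣ) : ∑ β : F, canonicalChar F (a * β) = 0 := by
  classical
  have h := sum_canonicalChar_mul (a : F)
  rw [if_neg a.ne_zero] at h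
  simpa only [mul_comm] using h

theorem sum_canonicalChar_trace {n N : ℕ} (g : Fin N ≃ Sp n F) (a : F) :
    ∑ k, canonicalChar F (a * (g k : Matrix (Fin n ⊕ Fin n) (Fin n ⊕ Fin n) F).trace) =
      ∑ β, (traceCount n F β : ℂ) * canonicalChar F (a * β) := by
  rw [sum_canonicalChar_eq_sum_card]
  refine sum_congr rfl fun β _ => ?_
  congr 2
  exact Nat.card_congr (g.subtypeEquiv fun k => Iff.rfl)

theorem gaussSum_Sp_one {N : ℕ} (g : Fin N ≃ Sp 1 F) (a : Fˣ) :
    ∑ k, canonicalChar F (a * (g k : Matrix (Fin 1 ⊕ Fin 1) (Fin 1 ⊕ Fin 1) F).trace) =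
      Fintype.card F * kloosterman (canonicalChar F) (a ^ 2) := by
  rw [sum_canonicalChar_trace]
  simp only [traceCount_one_eq, Nat.cast_add, add_mul, sum_add_distrib]
  rw [← mul_sum, sum_canonicalChar_unit, mul_zero, zero_add, ← sum_delta1_mul_canonicalChar,
    mul_sum]
  exact sum_congr rfl fun β _ => by push_cast; ring

end

end

/-! ### The order of `Sp(4, F)` -/

section

open Finset

open Classical in
theorem card_fiber_mul_card {G H : Type*} [AddGroup G] [AddGroup H] [Fintype G] [Fintype H]
    (f : G →+ H) (hf : Function.Surjective f) (b : H) :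
    #{x | f x = b} * Fintype.card H = Fintype.card G := by
  have h := card_eq_sum_card_fiberwise (s := univ) (f := f) (t := univ) (fun _ _ => mem_univ _)
  rw [card_univ] at h
  rw [h, sum_congr rfl fun c _ => AddMonoidHom.card_fiber_eq_of_mem_range f (hf c) (hf b), sum_const,
    card_univ, smul_eq_mul, mul_comm]

section

variable {F : Type*} [Field F]

/-- The bilinear form `x J yᵀ` on row vectors of length four; the rows of a matrix in `Sp(4, F)`
are the symplectic bases for it. -/
noncomputable def symplForm (F : Type*) [Field F] : LinearMap.BilinForm F (Fin 2 ⊕ Fin 2 → F) :=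
  Matrix.toBilin' (Matrix.J (Fin 2) F)

theorem symplForm_apply (x y : Fin 2 ⊕ Fin 2 → F) :
    symplForm F x y = x (.inr 0) * y (.inl 0) + x (.inr 1) * y (.inl 1)
      - x (.inl 0) * y (.inr 0) - x (.inl 1) * y (.inr 1) := by
  rw [symplForm, Matrix.toBilin'_apply']
  simp [dotProduct, Matrix.mulVec, Matrix.J, Fin.sum_univ_two, Matrix.one_apply]
  ring

theorem symplForm_self (x : Fin 2 ⊕ Fin 2 → F) : symplForm F x x = 0 := by
  rw [symplForm_apply]; ring

theorem symplForm_swap (x y : Fin 2 ⊕ Fin 2 → F) : symplForm F x y = -symplForm F y x := by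
  rw [symplForm_apply, symplForm_apply]; ring

theorem exists_symplForm_eq {x : Fin 2 ⊕ Fin 2 → F} (hx : x ≠ 0) (t : F) :
    ∃ z, symplForm F x z = t := by
  obtain ⟨i, hi⟩ := Function.ne_iff.1 hx
  rw [Pi.zero_apply] at hi
  have h1 : ∃ z, symplForm F x z ≠ 0 := by
    rcases i with i | i
    · refine ⟨Pi.single (.inr i) 1, ?_⟩
      fin_cases i <;> simpa [symplForm_apply] using hi
    · refine ⟨Pi.single (.inl i) 1, ?_⟩
      fin_cases i <;> simpa [symplForm_apply] using hi
  obtain ⟨z, hz⟩ := h1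
  exact ⟨(t / symplForm F x z) • z, by rw [map_smul, smul_eq_mul, div_mul_cancel₀ _ hz]⟩

theorem mem_Sp_two_iff (w : Matrix (Fin 2 ⊕ Fin 2) (Fin 2 ⊕ Fin 2) F) :
    w ∈ Sp 2 F ↔ symplForm F (w (.inl 0)) (w (.inr 0)) = -1 ∧
      (symplForm F (w (.inl 0)) (w (.inl 1)) = 0 ∧ symplForm F (w (.inr 0)) (w (.inl 1)) = 0) ∧
      symplForm F (w (.inl 0)) (w (.inr 1)) = 0 ∧ symplForm F (w (.inr 0)) (w (.inr 1)) = 0 ∧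
      symplForm F (w (.inl 1)) (w (.inr 1)) = -1 := by
  have h1 : ∀ i j, (w * Matrix.J (Fin 2) F * w.transpose) i j = symplForm F (w i) (w j) := by
    intro i j
    rw [symplForm, Matrix.toBilin'_apply', Matrix.mul_assoc, Matrix.mul_apply]
    rfl
  rw [SymplecticGroup.mem_iff, ← Matrix.ext_iff]
  simp only [h1]
  constructor
  · intro h
    simp only [h]
    simp [Matrix.J]
  · rintro ⟨h1, ⟨h2, h3⟩, h4, h5, h6⟩ i j
    have h1' := symplForm_swap (w (.inr 0)) (w (.inl 0))
    have h2' := symplForm_swap (w (.inl 1)) (w (.inl 0))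
    have h3' := symplForm_swap (w (.inl 1)) (w (.inr 0))
    have h4' := symplForm_swap (w (.inr 1)) (w (.inl 0))
    have h5' := symplForm_swap (w (.inr 1)) (w (.inr 0))
    have h6' := symplForm_swap (w (.inr 1)) (w (.inl 1))
    rcases i with i | i <;> rcases j with j | j <;> fin_cases i <;> fin_cases j <;>
      simp [Matrix.J, symplForm_self, *]

/-- A symplectic matrix of size four as a pair of orthogonal hyperbolic pairs of rows. -/
def hyperbolicPairsEquiv (F : Type*) [Field F] : Sp 2 F ≃
    {p : ((Fin 2 ⊕ Fin 2 → F) × (Fin 2 ⊕ Fin 2 → F)) ×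
        ((Fin 2 ⊕ Fin 2 → F) × (Fin 2 ⊕ Fin 2 → F)) //
      symplForm F p.1.1 p.1.2 = -1 ∧
      (symplForm F p.1.1 p.2.1 = 0 ∧ symplForm F p.1.2 p.2.1 = 0) ∧
      symplForm F p.1.1 p.2.2 = 0 ∧ symplForm F p.1.2 p.2.2 = 0 ∧
      symplForm F p.2.1 p.2.2 = -1} where
  toFun w := ⟨((w.1 (.inl 0), w.1 (.inr 0)), (w.1 (.inl 1), w.1 (.inr 1))),
    (mem_Sp_two_iff w.1).1 w.2⟩
  invFun p := ⟨Matrix.of (Sum.elim ![p.1.1.1, p.1.2.1] ![p.1.1.2, p.1.2.2]),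
    (mem_Sp_two_iff _).2 p.2⟩
  left_inv w := by
    apply Subtype.ext
    ext i j
    rcases i with i | i <;> fin_cases i <;> rfl
  right_inv p := rfl

variable [Fintype F]

open Classical in
theorem card_symplForm_eq_neg_one (x : Fin 2 ⊕ Fin 2 → F) :
    #{u | symplForm F x u = -1} = if x = 0 then 0 else Fintype.card F ^ 3 := by
  have hq : 0 < Fintype.card F := Fintype.card_pos
  split_ifs with hx
  · simp [hx]
  · have h := card_fiber_mul_card (symplForm F x).toAddMonoidHom (exists_symplForm_eq hx) (-1)
    rw [Fintype.card_pi, prod_const, card_univ, Fintype.card_sum, Fintype.card_fin] at h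
    exact Nat.eq_of_mul_eq_mul_right hq (h.trans (pow_succ _ 3))

open Classical in
/-- The number of hyperbolic pairs. -/
theorem card_hyperbolic_pairs :
    #{p : (Fin 2 ⊕ Fin 2 → F) × (Fin 2 ⊕ Fin 2 → F) | symplForm F p.1 p.2 = -1} =
      (Fintype.card F ^ 4 - 1) * Fintype.card F ^ 3 := by
  rw [card_filter_prod]
  simp only [card_symplForm_eq_neg_one]
  rw [sum_ite, sum_const_zero, zero_add, sum_const, filter_not, filter_eq' univ, if_pos (mem_univ _),
    card_sdiff_of_subset (subset_univ _), card_singleton, card_univ, Fintype.card_pi, prod_const,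
    card_univ, Fintype.card_sum, Fintype.card_fin, smul_eq_mul]

open Classical in
/-- The number of hyperbolic pairs orthogonal to a given hyperbolic pair. -/
theorem card_orthogonal_hyperbolic_pairs {x u : Fin 2 ⊕ Fin 2 → F} (h : symplForm F x u = -1) :
    #{p : (Fin 2 ⊕ Fin 2 → F) × (Fin 2 ⊕ Fin 2 → F) |
      (symplForm F x p.1 = 0 ∧ symplForm F u p.1 = 0) ∧
      symplForm F x p.2 = 0 ∧ symplForm F u p.2 = 0 ∧ symplForm F p.1 p.2 = -1} =
      (Fintype.card F ^ 2 - 1) * Fintype.card F := by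
  have hq : 0 < Fintype.card F := Fintype.card_pos
  have h' : symplForm F u x = 1 := by rw [symplForm_swap, h, neg_neg]
  have hV : Fintype.card (Fin 2 ⊕ Fin 2 → F) = Fintype.card F ^ 4 := by
    rw [Fintype.card_pi, prod_const, card_univ, Fintype.card_sum, Fintype.card_fin]
  -- the values `ω(x, z)` and `ω(u, z)` can be prescribed by a combination `z` of `x` and `u`
  have hcomb : ∀ s t : F, symplForm F x (t • x - s • u) = s ∧ symplForm F u (t • x - s • u) = t := by
    intro s t
    simp [symplForm_self, h, h']
  have hy : #{y | symplForm F x y = 0 ∧ symplForm F u y = 0} = Fintype.card F ^ 2 := by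
    have h1 := card_fiber_mul_card ((symplForm F x).prod (symplForm F u)).toAddMonoidHom
      (fun b => ⟨_, Prod.ext (hcomb b.1 b.2).1 (hcomb b.1 b.2).2⟩) 0
    rw [hV, Fintype.card_prod] at h1
    have h2 : Fintype.card F ^ 4 = Fintype.card F ^ 2 * (Fintype.card F * Fintype.card F) := by ring
    rw [← Nat.eq_of_mul_eq_mul_right (by positivity) (h1.trans h2)]
    congr 1
    ext y
    simp [Prod.ext_iff]
  have hv : ∀ y, symplForm F x y = 0 → symplForm F u y = 0 → y ≠ 0 →
      #{v | symplForm F x v = 0 ∧ symplForm F u v = 0 ∧ symplForm F y v = -1} =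
        Fintype.card F := by
    intro y hxy huy hy0
    have hsurj : Function.Surjective
        ((symplForm F x).prod ((symplForm F u).prod (symplForm F y))).toAddMonoidHom := by
      rintro ⟨s, t, r⟩
      obtain ⟨z, hz⟩ := exists_symplForm_eq hy0 r
      have hyx : symplForm F y x = 0 := by rw [symplForm_swap, hxy, neg_zero]
      have hyu : symplForm F y u = 0 := by rw [symplForm_swap, huy, neg_zero]
      refine ⟨z + ((t - symplForm F u z) • x - (s - symplForm F x z) • u), ?_⟩
      simp [symplForm_self, h, h', hyx, hyu, hz]
    have h1 := card_fiber_mul_card _ hsurj (0, 0, -1)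
    rw [hV, Fintype.card_prod, Fintype.card_prod] at h1
    have h2 : Fintype.card F ^ 4
        = Fintype.card F * (Fintype.card F * (Fintype.card F * Fintype.card F)) := by ring
    rw [← Nat.eq_of_mul_eq_mul_right (by positivity) (h1.trans h2)]
    congr 1
    ext y
    simp
  rw [card_filter_prod]
  have hterm : ∀ y, #{v | (symplForm F x y = 0 ∧ symplForm F u y = 0) ∧
      symplForm F x v = 0 ∧ symplForm F u v = 0 ∧ symplForm F y v = -1} =
      if y ∈ ({y | symplForm F x y = 0 ∧ symplForm F u y = 0} : Finset _).erase 0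
        then Fintype.card F else 0 := by
    intro y
    split_ifs with hy1
    · simp only [mem_erase, mem_filter, mem_univ, true_and] at hy1
      rw [← hv y hy1.2.1 hy1.2.2 hy1.1]
      simp [hy1.2]
    · rw [card_eq_zero, filter_eq_empty_iff]
      rintro v - ⟨h1, -, -, h2⟩
      refine hy1 (mem_erase.2 ⟨?_, mem_filter.2 ⟨mem_univ _, h1⟩⟩)
      rintro rfl
      simp at h2
  rw [sum_congr rfl fun y _ => hterm y, sum_ite_mem, univ_inter, sum_const, smul_eq_mul,
    card_erase_of_mem (by simp), hy]

theorem card_Sp_two :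
    Nat.card (Sp 2 F) = Fintype.card F ^ 4 * (Fintype.card F ^ 2 - 1) * (Fintype.card F ^ 4 - 1) := by
  classical
  rw [Nat.card_congr (hyperbolicPairsEquiv F), Nat.card_eq_fintype_card, Fintype.card_subtype,
    card_filter_prod]
  have hterm : ∀ a : (Fin 2 ⊕ Fin 2 → F) × (Fin 2 ⊕ Fin 2 → F),
      #{p : (Fin 2 ⊕ Fin 2 → F) × (Fin 2 ⊕ Fin 2 → F) | symplForm F a.1 a.2 = -1 ∧
        (symplForm F a.1 p.1 = 0 ∧ symplForm F a.2 p.1 = 0) ∧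
        symplForm F a.1 p.2 = 0 ∧ symplForm F a.2 p.2 = 0 ∧ symplForm F p.1 p.2 = -1} =
      if symplForm F a.1 a.2 = -1 then (Fintype.card F ^ 2 - 1) * Fintype.card F else 0 := by
    intro a
    split_ifs with h
    · rw [← card_orthogonal_hyperbolic_pairs h]
      simp [h]
    · simp [h]
  rw [sum_congr rfl fun a _ => hterm a, ← sum_filter, sum_const, card_hyperbolic_pairs, smul_eq_mul]
  ring

end

end

/-! ### Symplectic matrices by their lower left block -/

section

open Finset Matrix

section

variable {F : Type*} [Field F]

/-- The unipotent matrix with blocks `1, X, 0, 1`. -/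
def upperUnipotent (X : Matrix (Fin 2) (Fin 2) F) : Matrix (Fin 2 ⊕ Fin 2) (Fin 2 ⊕ Fin 2) F :=
  fromBlocks 1 X 0 1

theorem upperUnipotent_mem {X : Matrix (Fin 2) (Fin 2) F} (hX : Xᵀ = X) :
    upperUnipotent X ∈ Sp 2 F := by
  rw [upperUnipotent, SymplecticGroup.fromBlocks_mem_iff]
  simp [hX]

theorem trace_fromBlocks_eq (A B C D : Matrix (Fin 2) (Fin 2) F) :
    (fromBlocks A B C D).trace = A.trace + D.trace := by
  simp [Matrix.trace, Fintype.sum_sum_type]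

theorem toBlocks₂₁_upperUnipotent_mul (X : Matrix (Fin 2) (Fin 2) F)
    (w : Matrix (Fin 2 ⊕ Fin 2) (Fin 2 ⊕ Fin 2) F) :
    (upperUnipotent X * w).toBlocks₂₁ = w.toBlocks₂₁ := by
  conv_lhs => rw [← fromBlocks_toBlocks w, upperUnipotent, fromBlocks_multiply]
  simp

theorem trace_upperUnipotent_mul (X : Matrix (Fin 2) (Fin 2) F)
    (w : Matrix (Fin 2 ⊕ Fin 2) (Fin 2 ⊕ Fin 2) F) :
    (upperUnipotent X * w).trace = w.trace + (X * w.toBlocks₂₁).trace := by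
  conv_lhs => rw [← fromBlocks_toBlocks w, upperUnipotent, fromBlocks_multiply]
  conv_rhs => rw [← fromBlocks_toBlocks w]
  rw [trace_fromBlocks_eq, trace_fromBlocks_eq]
  simp
  ring

theorem upperUnipotent_mul (X Y : Matrix (Fin 2) (Fin 2) F) :
    upperUnipotent X * upperUnipotent Y = upperUnipotent (X + Y) := by
  simp [upperUnipotent, fromBlocks_multiply, add_comm]

theorem upperUnipotent_zero : upperUnipotent (0 : Matrix (Fin 2) (Fin 2) F) = 1 := by
  simp [upperUnipotent]

/-- Alternating matrices of size two. -/
def IsAlternating (C : Matrix (Fin 2) (Fin 2) F) : Prop :=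
  C 0 0 = 0 ∧ C 1 1 = 0 ∧ C 0 1 + C 1 0 = 0

/-- The trace form pairs a matrix that is not alternating nontrivially with symmetric matrices. -/
theorem exists_symm_trace_mul_eq_one {C : Matrix (Fin 2) (Fin 2) F} (hC : ¬IsAlternating C) :
    ∃ X : Matrix (Fin 2) (Fin 2) F, Xᵀ = X ∧ (X * C).trace = 1 := by
  by_cases h0 : C 0 0 = 0
  · by_cases h1 : C 1 1 = 0
    · have h2 : C 0 1 + C 1 0 ≠ 0 := fun h => hC ⟨h0, h1, h⟩
      refine ⟨!![0, (C 0 1 + C 1 0)⁻¹; (C 0 1 + C 1 0)⁻¹, 0], ?_, ?_⟩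
      · ext i j
        fin_cases i <;> fin_cases j <;> rfl
      · simp only [trace_fin_two, Matrix.mul_apply, Fin.sum_univ_two, of_apply, cons_val_zero,
          cons_val_one, cons_val', cons_val_fin_one]
        linear_combination inv_mul_cancel₀ h2
    · refine ⟨!![0, 0; 0, (C 1 1)⁻¹], ?_, ?_⟩
      · ext i j
        fin_cases i <;> fin_cases j <;> rfl
      · simp [trace_fin_two, Matrix.vecMul, dotProduct, Fin.sum_univ_two, h1]
  · refine ⟨!![(C 0 0)⁻¹, 0; 0, 0], ?_, ?_⟩
    · ext i j
      fin_cases i <;> fin_cases j <;> rfl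
    · simp [trace_fin_two, Matrix.vecMul, dotProduct, Fin.sum_univ_two, h0]

open Classical in
/-- Among the symplectic matrices whose lower left block is not alternating, all traces occur
equally often: multiplying by unipotent matrices shifts the trace. -/
theorem card_trace_eq_of_not_isAlternating [Fintype F] (β β' : F) :
    #{w : Sp 2 F | ¬IsAlternating w.1.toBlocks₂₁ ∧ w.1.trace = β} =
      #{w : Sp 2 F | ¬IsAlternating w.1.toBlocks₂₁ ∧ w.1.trace = β'} := by
  let ξ : Matrix (Fin 2) (Fin 2) F → Matrix (Fin 2) (Fin 2) F := fun C =>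
    if h : ¬IsAlternating C then (exists_symm_trace_mul_eq_one h).choose else 0
  have hξs : ∀ C, (ξ C)ᵀ = ξ C := by
    intro C
    by_cases h : ¬IsAlternating C
    · simp only [ξ, dif_pos h]
      exact (exists_symm_trace_mul_eq_one h).choose_spec.1
    · simp only [ξ, dif_neg h, transpose_zero]
  have hξt : ∀ C, ¬IsAlternating C → (ξ C * C).trace = 1 := by
    intro C h
    simp only [ξ, dif_pos h]
    exact (exists_symm_trace_mul_eq_one h).choose_spec.2
  let φ : F → Sp 2 F → Sp 2 F := fun t w =>
    ⟨upperUnipotent (t • ξ w.1.toBlocks₂₁) * w.1,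
      mul_mem (upperUnipotent_mem (by rw [transpose_smul, hξs])) w.2⟩
  have hφC : ∀ t w, (φ t w).1.toBlocks₂₁ = w.1.toBlocks₂₁ := fun t w =>
    toBlocks₂₁_upperUnipotent_mul _ _
  have hφt : ∀ t (w : Sp 2 F), ¬IsAlternating w.1.toBlocks₂₁ →
      (φ t w).1.trace = w.1.trace + t := by
    intro t w h
    simp only [φ]
    rw [trace_upperUnipotent_mul, Matrix.smul_mul, trace_smul, hξt _ h, smul_eq_mul, mul_one]
  have hφφ : ∀ t w, φ (-t) (φ t w) = w := by
    intro t w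
    apply Subtype.ext
    change upperUnipotent (-t • ξ (φ t w).1.toBlocks₂₁) *
      (upperUnipotent (t • ξ w.1.toBlocks₂₁) * w.1) = w.1
    rw [hφC, ← Matrix.mul_assoc, upperUnipotent_mul, neg_smul, neg_add_cancel, upperUnipotent_zero,
      Matrix.one_mul]
  refine card_nbij' (φ (β' - β)) (φ (β - β')) ?_ ?_ ?_ ?_
  · intro w hw
    simp only [coe_filter, mem_univ, true_and, Set.mem_ofPred_eq] at hw ⊢
    rw [hφC, hφt _ _ hw.1, hw.2]
    exact ⟨hw.1, add_sub_cancel _ _⟩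
  · intro w hw
    simp only [coe_filter, mem_univ, true_and, Set.mem_ofPred_eq] at hw ⊢
    rw [hφC, hφt _ _ hw.1, hw.2]
    exact ⟨hw.1, add_sub_cancel _ _⟩
  · intro w _
    rw [← neg_sub β' β, hφφ]
  · intro w _
    rw [← neg_sub β β', hφφ]

/-- The symplectic matrices of trace `β` with vanishing lower left block are the products of
`diag(A, ᵗA⁻¹)` with unipotent matrices. -/
noncomputable def parabolicEquiv (F : Type*) [Field F] (β : F) :
    {w : Sp 2 F // w.1.toBlocks₂₁ = 0 ∧ w.1.trace = β} ≃
      {A : Matrix (Fin 2) (Fin 2) F // A.det ≠ 0 ∧ A.trace + A⁻¹.trace = β} ×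
        {S : Matrix (Fin 2) (Fin 2) F // Sᵀ = S} where
  toFun w := (⟨w.1.1.toBlocks₁₁, by
    obtain ⟨⟨w, hw⟩, hC, ht⟩ := w
    dsimp only at hC ht ⊢
    rw [← fromBlocks_toBlocks w, hC] at hw ht
    rw [SymplecticGroup.fromBlocks_mem_iff] at hw
    have h1 : w.toBlocks₁₁ᵀ * w.toBlocks₂₂ = 1 := by simpa using hw.2.2
    have h2 : w.toBlocks₂₂ᵀ * w.toBlocks₁₁ = 1 := by simpa using congrArg transpose h1
    refine ⟨Matrix.det_ne_zero_of_left_inverse h2, ?_⟩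
    rw [inv_eq_left_inv h2, trace_transpose, ← ht, trace_fromBlocks_eq]⟩,
    ⟨w.1.1.toBlocks₁₂ * w.1.1.toBlocks₁₁ᵀ, by
    obtain ⟨⟨w, hw⟩, hC, ht⟩ := w
    dsimp only at hC ht ⊢
    rw [← fromBlocks_toBlocks w, hC] at hw
    rw [SymplecticGroup.fromBlocks_mem_iff] at hw
    have h1 : w.toBlocks₁₁ᵀ * w.toBlocks₂₂ = 1 := by simpa using hw.2.2
    have h2 : w.toBlocks₂₂ᵀ * w.toBlocks₁₁ = 1 := by simpa using congrArg transpose h1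
    have h3 : w.toBlocks₁₁ * w.toBlocks₂₂ᵀ = 1 := mul_eq_one_comm.1 h2
    have h4 : w.toBlocks₂₂ * w.toBlocks₁₁ᵀ = 1 := mul_eq_one_comm.1 h1
    rw [transpose_mul, transpose_transpose]
    calc w.toBlocks₁₁ * w.toBlocks₁₂ᵀ
        = w.toBlocks₁₁ * w.toBlocks₁₂ᵀ * (w.toBlocks₂₂ * w.toBlocks₁₁ᵀ) := by
          rw [h4, Matrix.mul_one]
      _ = w.toBlocks₁₁ * (w.toBlocks₁₂ᵀ * w.toBlocks₂₂) * w.toBlocks₁₁ᵀ := by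
          simp only [Matrix.mul_assoc]
      _ = (w.toBlocks₁₁ * w.toBlocks₂₂ᵀ) * w.toBlocks₁₂ * w.toBlocks₁₁ᵀ := by
          rw [hw.2.1]; simp only [Matrix.mul_assoc]
      _ = _ := by rw [h3, Matrix.one_mul]⟩)
  invFun p := ⟨⟨fromBlocks p.1.1 (p.2.1 * p.1.1⁻¹ᵀ) 0 p.1.1⁻¹ᵀ, by
    obtain ⟨⟨A, hA, ht⟩, ⟨S, hS⟩⟩ := p
    dsimp only
    rw [SymplecticGroup.fromBlocks_mem_iff]
    refine ⟨by simp, ?_, ?_⟩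
    · simp only [transpose_mul, transpose_transpose, hS, Matrix.mul_assoc]
    · rw [transpose_zero, Matrix.zero_mul, sub_zero, ← transpose_mul,
        nonsing_inv_mul _ (isUnit_iff_ne_zero.2 hA), transpose_one]⟩, by
    obtain ⟨⟨A, hA, ht⟩, ⟨S, hS⟩⟩ := p
    exact ⟨toBlocks_fromBlocks₂₁ _ _ _ _, by
      dsimp only
      rw [trace_fromBlocks_eq, trace_transpose, ht]⟩⟩
  left_inv w := by
    obtain ⟨⟨w, hw⟩, hC, ht⟩ := w
    apply Subtype.ext
    apply Subtype.ext
    dsimp only at hC ⊢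
    have hw' := hw
    rw [← fromBlocks_toBlocks w, hC] at hw'
    rw [SymplecticGroup.fromBlocks_mem_iff] at hw'
    have h1 : w.toBlocks₁₁ᵀ * w.toBlocks₂₂ = 1 := by simpa using hw'.2.2
    have h2 : w.toBlocks₂₂ᵀ * w.toBlocks₁₁ = 1 := by simpa using congrArg transpose h1
    conv_rhs => rw [← fromBlocks_toBlocks w, hC]
    rw [inv_eq_left_inv h2, transpose_transpose, Matrix.mul_assoc, h1, Matrix.mul_one]
  right_inv p := by
    obtain ⟨⟨A, hA, ht⟩, ⟨S, hS⟩⟩ := p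
    refine Prod.ext (Subtype.ext ?_) (Subtype.ext ?_)
    · exact toBlocks_fromBlocks₁₁ _ _ _ _
    · dsimp only
      rw [toBlocks_fromBlocks₁₁, toBlocks_fromBlocks₁₂, Matrix.mul_assoc, ← transpose_mul,
        mul_nonsing_inv _ (isUnit_iff_ne_zero.2 hA), transpose_one, Matrix.mul_one]

/-- Symmetric matrices of size two are given by three entries. -/
def symmetricEquiv (F : Type*) : {S : Matrix (Fin 2) (Fin 2) F // Sᵀ = S} ≃ F × F × F where
  toFun S := (S.1 0 0, S.1 0 1, S.1 1 1)
  invFun p := ⟨!![p.1, p.2.1; p.2.1, p.2.2], by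
    ext i j
    fin_cases i <;> fin_cases j <;> rfl⟩
  left_inv S := by
    obtain ⟨S, hS⟩ := S
    have h : S 1 0 = S 0 1 := congrFun (congrFun hS 0) 1
    apply Subtype.ext
    ext i j
    fin_cases i <;> fin_cases j <;> simp [h]
  right_inv p := rfl

theorem apply_zero_one_ne_zero {C : Matrix (Fin 2) (Fin 2) F} (hC : IsAlternating C) (h0 : C ≠ 0) :
    C 0 1 ≠ 0 := by
  obtain ⟨h1, h2, h3⟩ := hC
  intro h5
  apply h0
  rw [h5, zero_add] at h3
  ext i j
  fin_cases i <;> fin_cases j <;> simp [h1, h2, h3, h5]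

/-- If the lower left block of a symplectic matrix is alternating and nonzero, then the diagonal
blocks have trace zero and the upper right block is determined by the other ones. -/
theorem entries_of_isAlternating {A B C D : Matrix (Fin 2) (Fin 2) F}
    (h : fromBlocks A B C D ∈ Sp 2 F) (hC : IsAlternating C) (h0 : C ≠ 0) :
    C 1 0 = -C 0 1 ∧ A 1 1 = -A 0 0 ∧ D 1 1 = -D 0 0 ∧
      B 0 0 = (C 0 1)⁻¹ * (A 0 1 * D 0 0 - A 0 0 * D 1 0) ∧
      B 0 1 = (C 0 1)⁻¹ * (A 0 1 * D 0 1 + A 0 0 * D 0 0 - 1) ∧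
      B 1 0 = (C 0 1)⁻¹ * (1 - A 0 0 * D 0 0 - A 1 0 * D 1 0) ∧
      B 1 1 = (C 0 1)⁻¹ * (A 1 0 * D 0 0 - A 0 0 * D 0 1) := by
  have hc := apply_zero_one_ne_zero hC h0
  obtain ⟨h1, h2, h3⟩ := hC
  have h10 : C 1 0 = -C 0 1 := by linear_combination h3
  have ht := SymplecticGroup.transpose_mem h
  rw [fromBlocks_transpose, SymplecticGroup.fromBlocks_mem_iff] at ht
  rw [SymplecticGroup.fromBlocks_mem_iff] at h
  have hA : A 1 1 = -A 0 0 := by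
    have := congrFun (congrFun h.1 0) 1
    simp only [Matrix.mul_apply, Fin.sum_univ_two, transpose_apply, h1, h2, h10] at this
    exact mul_left_cancel₀ hc (by linear_combination this)
  have hD : D 1 1 = -D 0 0 := by
    have := congrFun (congrFun ht.2.1 0) 1
    simp only [Matrix.mul_apply, Fin.sum_univ_two, transpose_apply, h1, h2, h10] at this
    exact mul_left_cancel₀ hc (by linear_combination this)
  have hB := fun i j => congrFun (congrFun h.2.2 i) j
  simp only [Matrix.sub_apply, Matrix.mul_apply, Fin.sum_univ_two, transpose_apply] at hB
  have h00 := hB 0 0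
  have h01 := hB 0 1
  have h10' := hB 1 0
  have h11 := hB 1 1
  simp only [h1, h2, h10, hA, hD, Matrix.one_apply, if_true, Fin.zero_eq_one_iff,
    Fin.one_eq_zero_iff, OfNat.ofNat_ne_one, if_false] at h00 h01 h10' h11
  refine ⟨h10, hA, hD, ?_, ?_, ?_, ?_⟩
  · exact (eq_inv_mul_iff_mul_eq₀ hc).2 (by linear_combination -h10')
  · exact (eq_inv_mul_iff_mul_eq₀ hc).2 (by linear_combination -h11)
  · exact (eq_inv_mul_iff_mul_eq₀ hc).2 (by linear_combination h00)
  · exact (eq_inv_mul_iff_mul_eq₀ hc).2 (by linear_combination h01)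

/-- The symplectic matrices whose lower left block is alternating and nonzero, parametrized by
that block and by the diagonal blocks, which are arbitrary matrices of trace zero. -/
noncomputable def alternatingEquiv (F : Type*) [Field F] :
    {w : Sp 2 F // IsAlternating w.1.toBlocks₂₁ ∧ w.1.toBlocks₂₁ ≠ 0} ≃
      Fˣ × (F × F × F) × (F × F × F) where
  toFun w := (Units.mk0 (w.1.1.toBlocks₂₁ 0 1) (apply_zero_one_ne_zero w.2.1 w.2.2),
    (w.1.1.toBlocks₁₁ 0 0, w.1.1.toBlocks₁₁ 0 1, w.1.1.toBlocks₁₁ 1 0),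
    (w.1.1.toBlocks₂₂ 0 0, w.1.1.toBlocks₂₂ 0 1, w.1.1.toBlocks₂₂ 1 0))
  invFun := fun ⟨c, (a, b, d), (a', b', d')⟩ => ⟨⟨fromBlocks
      !![a, b; d, -a]
      !![(c : F)⁻¹ * (b * a' - a * d'), (c : F)⁻¹ * (b * b' + a * a' - 1);
        (c : F)⁻¹ * (1 - a * a' - d * d'), (c : F)⁻¹ * (d * a' - a * b')]
      !![0, (c : F); -(c : F), 0]
      !![a', b'; d', -a'], by
    have hc : (c : F) ≠ 0 := c.ne_zero
    rw [SymplecticGroup.fromBlocks_mem_iff]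
    refine ⟨?_, ?_, ?_⟩
    · ext i j
      fin_cases i <;> fin_cases j <;> simp [Matrix.mul_apply, Fin.sum_univ_two, mul_comm]
    · ext i j
      fin_cases i <;> fin_cases j <;> simp [Matrix.mul_apply, Fin.sum_univ_two] <;> ring
    · ext i j
      fin_cases i <;> fin_cases j <;> simp [Matrix.mul_apply, Fin.sum_univ_two, hc]; ring⟩, by
    have hc : (c : F) ≠ 0 := c.ne_zero
    dsimp only
    rw [toBlocks_fromBlocks₂₁]
    refine ⟨?_, fun h => hc ?_⟩
    · simp [IsAlternating]
    · simpa using congrFun (congrFun h 0) 1⟩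
  left_inv w := by
    obtain ⟨⟨w, hw⟩, hC, h0⟩ := w
    apply Subtype.ext
    apply Subtype.ext
    dsimp only [Units.val_mk0] at *
    have hw' := hw
    rw [← fromBlocks_toBlocks w] at hw'
    obtain ⟨h1, h2, h3, h4, h5, h6, h7⟩ := entries_of_isAlternating hw' hC h0
    conv_rhs => rw [← fromBlocks_toBlocks w]
    rw [fromBlocks_inj]
    refine ⟨?_, ?_, ?_, ?_⟩ <;> ext i j <;> fin_cases i <;> fin_cases j
    all_goals simp only [Fin.zero_eta, Fin.mk_one, of_apply, cons_val_zero, cons_val_one, cons_val',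
      cons_val_fin_one, h1, h2, h3, h4, h5, h6, h7, hC.1, hC.2.1]
  right_inv := by
    rintro ⟨c, ⟨a, b, d⟩, ⟨a', b', d'⟩⟩
    refine Prod.ext (Units.ext ?_) (Prod.ext ?_ ?_) <;> simp

end

end

/-! ### The trace distribution of `Sp(4, F)` -/

section

open Finset Matrix

section

variable {F : Type*} [Field F]

theorem trace_inv_fin_two (A : Matrix (Fin 2) (Fin 2) F) : A⁻¹.trace = A.trace * A.det⁻¹ := by
  rw [Matrix.inv_def, trace_smul, adjugate_fin_two, trace_fin_two, trace_fin_two, Ring.inverse_eq_inv']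
  simp only [of_apply, cons_val_zero, cons_val_one, cons_val', cons_val_fin_one, smul_eq_mul]
  ring

/-- Upper triangular invertible matrices with prescribed value of `tr A + tr A⁻¹`. -/
noncomputable def borelEquiv (F : Type*) [Field F] (β : F) :
    {A : Matrix (Fin 2) (Fin 2) F // (A.det ≠ 0 ∧ A.trace + A⁻¹.trace = β) ∧ A 1 0 = 0} ≃
      F × {p : Fˣ × Fˣ // (p.1 : F) + (p.1 : F)⁻¹ + (p.2 : F) + (p.2 : F)⁻¹ = β} where
  toFun A :=
    have h : A.1 0 0 * A.1 1 1 ≠ 0 := by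
      have := A.2.1.1
      rwa [det_fin_two, A.2.2, mul_zero, sub_zero] at this
    (A.1 0 1, ⟨(Units.mk0 (A.1 0 0) (left_ne_zero_of_mul h),
      Units.mk0 (A.1 1 1) (right_ne_zero_of_mul h)), by
        have h1 := A.2.1.2
        have h2 := left_ne_zero_of_mul h
        have h3 := right_ne_zero_of_mul h
        rw [trace_inv_fin_two, det_fin_two, A.2.2, mul_zero, sub_zero, trace_fin_two] at h1
        refine Eq.trans ?_ h1
        simp only [Units.val_mk0]
        field_simp
        ring⟩)
  invFun p := ⟨!![(p.2.1.1 : F), p.1; 0, (p.2.1.2 : F)], by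
    obtain ⟨b, ⟨a, d⟩, h⟩ := p
    have ha : (a : F) ≠ 0 := a.ne_zero
    have hd : (d : F) ≠ 0 := d.ne_zero
    dsimp only at h ⊢
    rw [trace_inv_fin_two, det_fin_two, trace_fin_two, ← h]
    simp only [of_apply, cons_val_zero, cons_val_one, cons_val', cons_val_fin_one, mul_zero,
      sub_zero, and_true]
    refine ⟨mul_ne_zero ha hd, ?_⟩
    field_simp
    ring⟩
  left_inv A := by
    have h := A.2.2
    apply Subtype.ext
    ext i j
    fin_cases i <;> fin_cases j <;> simp [h]
  right_inv p := Prod.ext rfl (Subtype.ext (Prod.ext (Units.ext rfl) (Units.ext rfl)))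

/-- Invertible matrices with nonzero lower left entry and prescribed value of `tr A + tr A⁻¹`,
parametrized by that entry, the upper left entry, the determinant and the trace. -/
noncomputable def bigCellEquiv (F : Type*) [Field F] (β : F) :
    {A : Matrix (Fin 2) (Fin 2) F // (A.det ≠ 0 ∧ A.trace + A⁻¹.trace = β) ∧ A 1 0 ≠ 0} ≃
      (Fˣ × F) × {p : Fˣ × F // p.2 * (1 + (p.1 : F)⁻¹) = β} where
  toFun A := ((Units.mk0 (A.1 1 0) A.2.2, A.1 0 0), ⟨(Units.mk0 A.1.det A.2.1.1, A.1.trace), by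
    have h := A.2.1.2
    rw [trace_inv_fin_two] at h
    refine Eq.trans ?_ h
    rw [Units.val_mk0]
    ring⟩)
  invFun p := ⟨!![p.1.2, (p.1.2 * (p.2.1.2 - p.1.2) - p.2.1.1) * (p.1.1 : F)⁻¹;
      (p.1.1 : F), p.2.1.2 - p.1.2], by
    obtain ⟨⟨c, a⟩, ⟨e, s⟩, h⟩ := p
    have hc : (c : F) ≠ 0 := c.ne_zero
    dsimp only at h ⊢
    rw [trace_inv_fin_two, det_fin_two, trace_fin_two, ← h]
    simp only [of_apply, cons_val_zero, cons_val_one, cons_val', cons_val_fin_one, mul_assoc,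
      inv_mul_cancel₀ hc, mul_one, sub_sub_cancel, add_sub_cancel]
    exact ⟨⟨e.ne_zero, by ring⟩, hc⟩⟩
  left_inv A := by
    have h := A.2.2
    apply Subtype.ext
    ext i j
    fin_cases i <;> fin_cases j <;> simp [det_fin_two, trace_fin_two, h]
  right_inv p := by
    obtain ⟨⟨c, a⟩, ⟨e, s⟩, h⟩ := p
    have hc : (c : F) ≠ 0 := c.ne_zero
    refine Prod.ext (Prod.ext (Units.ext ?_) ?_) (Subtype.ext (Prod.ext (Units.ext ?_) ?_)) <;>
      simp [det_fin_two, trace_fin_two, hc]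

theorem trace_eq_zero_of_isAlternating (w : Sp 2 F) (hC : IsAlternating w.1.toBlocks₂₁)
    (h0 : w.1.toBlocks₂₁ ≠ 0) : w.1.trace = 0 := by
  have hw := w.2
  rw [← fromBlocks_toBlocks w.1] at hw
  obtain ⟨-, hA, hD, -⟩ := entries_of_isAlternating hw hC h0
  rw [← fromBlocks_toBlocks w.1, trace_fromBlocks_eq, trace_fin_two, trace_fin_two, hA, hD]
  ring

variable [Fintype F]

open Classical in
theorem card_mul_one_add_inv_eq (β : F) :
    #{p : Fˣ × F | p.2 * (1 + (p.1 : F)⁻¹) = β} =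
      (Fintype.card F - 2) + if β = 0 then Fintype.card F else 0 := by
  rw [card_filter_prod, ← add_sum_erase univ _ (mem_univ (-1 : Fˣ)), add_comm]
  congr 1
  · rw [sum_congr rfl (g := fun _ => 1), sum_const, card_erase_of_mem (mem_univ _), card_univ,
      smul_eq_mul, mul_one, Fintype.card_units, Nat.sub_sub]
    intro e he
    have h : 1 + (e : F)⁻¹ ≠ 0 := by
      intro h
      refine ne_of_mem_erase he (inv_injective (Units.ext ?_))
      rw [Units.val_inv_eq_inv_val, inv_neg_one, Units.val_neg, Units.val_one]
      linear_combination h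
    rw [card_eq_one]
    refine ⟨β * (1 + (e : F)⁻¹)⁻¹, ?_⟩
    ext s
    simp only [mem_filter, mem_univ, true_and, mem_singleton]
    rw [eq_mul_inv_iff_mul_eq₀ h]
  · have h : (1 : F) + ((-1 : Fˣ) : F)⁻¹ = 0 := by
      rw [Units.val_neg, Units.val_one, inv_neg_one, add_neg_cancel]
    simp only [h, mul_zero, eq_comm (a := (0 : F))]
    split_ifs <;> simp_all

open Classical in
/-- The distribution of `tr A + tr A⁻¹` on the invertible matrices of size two. -/
theorem card_trace_add_trace_inv (β : F) :
    Nat.card {A : Matrix (Fin 2) (Fin 2) F // A.det ≠ 0 ∧ A.trace + A⁻¹.trace = β} =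
      Fintype.card F * delta2 β + (Fintype.card F - 1) * Fintype.card F *
        ((Fintype.card F - 2) + if β = 0 then Fintype.card F else 0) := by
  classical
  rw [Nat.card_eq_fintype_card, Fintype.card_subtype,
    ← card_filter_add_card_filter_not (fun A : Matrix (Fin 2) (Fin 2) F => A 1 0 = 0),
    filter_filter, filter_filter, ← Fintype.card_subtype, ← Fintype.card_subtype,
    Fintype.card_congr (borelEquiv F β), Fintype.card_congr (bigCellEquiv F β), Fintype.card_prod,
    Fintype.card_prod, Fintype.card_prod, Fintype.card_units, ← card_mul_one_add_inv_eq,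
    Fintype.card_subtype (fun p : Fˣ × F => p.2 * (1 + (p.1 : F)⁻¹) = β), delta2,
    Nat.card_eq_fintype_card]

open Classical in
/-- The trace distribution on `Sp(4, F)`, up to a constant. The three summands count the matrices whose
lower left block vanishes, is alternating and nonzero, or is not alternating. -/
theorem exists_traceCount_two_eq : ∃ c : ℕ, ∀ β : F, traceCount 2 F β =
    (Fintype.card F * delta2 β + (Fintype.card F - 1) * Fintype.card F *
        ((Fintype.card F - 2) + if β = 0 then Fintype.card F else 0)) * Fintype.card F ^ 3 +
      (if β = 0 then (Fintype.card F - 1) * Fintype.card F ^ 6 else 0) + c := by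
  classical
  refine ⟨#{w : Sp 2 F | ¬IsAlternating w.1.toBlocks₂₁ ∧ w.1.trace = 0}, fun β => ?_⟩
  have h1 : #{w : Sp 2 F | w.1.toBlocks₂₁ = 0 ∧ w.1.trace = β} =
      (Fintype.card F * delta2 β + (Fintype.card F - 1) * Fintype.card F *
        ((Fintype.card F - 2) + if β = 0 then Fintype.card F else 0)) * Fintype.card F ^ 3 := by
    rw [← card_trace_add_trace_inv, ← Fintype.card_subtype,
      Fintype.card_congr (parabolicEquiv F β), Fintype.card_prod,
      Fintype.card_congr (symmetricEquiv F), Nat.card_eq_fintype_card, Fintype.card_prod,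
      Fintype.card_prod]
    ring
  have h2 : #{w : Sp 2 F | (IsAlternating w.1.toBlocks₂₁ ∧ w.1.toBlocks₂₁ ≠ 0) ∧ w.1.trace = β} =
      if β = 0 then (Fintype.card F - 1) * Fintype.card F ^ 6 else 0 := by
    split_ifs with h
    · rw [filter_congr (q := fun w : Sp 2 F =>
        IsAlternating w.1.toBlocks₂₁ ∧ w.1.toBlocks₂₁ ≠ 0) fun w _ => ?_, ← Fintype.card_subtype,
        Fintype.card_congr (alternatingEquiv F)]
      · simp only [Fintype.card_prod, Fintype.card_units]
        ring
      · rw [and_iff_left_iff_imp, h]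
        exact fun h => trace_eq_zero_of_isAlternating w h.1 h.2
    · rw [card_eq_zero, filter_eq_empty_iff]
      rintro w - ⟨h3, h4⟩
      exact h (h4.symm.trans (trace_eq_zero_of_isAlternating w h3.1 h3.2))
  have h3 : IsAlternating (0 : Matrix (Fin 2) (Fin 2) F) := by simp [IsAlternating]
  rw [← h1, ← h2, ← card_trace_eq_of_not_isAlternating β 0, traceCount, Nat.card_eq_fintype_card,
    Fintype.card_subtype,
    ← card_filter_add_card_filter_not (fun w : Sp 2 F => IsAlternating w.1.toBlocks₂₁),
    ← card_filter_add_card_filter_not (s := filter _ (filter _ _))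
      (fun w : Sp 2 F => w.1.toBlocks₂₁ = 0)]
  simp only [filter_filter]
  congr 2
  · congr 1
    refine filter_congr fun w _ => ?_
    constructor
    · rintro ⟨⟨ha, -⟩, hb⟩
      exact ⟨hb, ha⟩
    · rintro ⟨hb, ha⟩
      exact ⟨⟨ha, hb ▸ h3⟩, hb⟩
  · congr 1
    refine filter_congr fun w _ => ?_
    tauto
  · refine filter_congr fun w _ => ?_
    tauto

theorem sum_delta2 : ∑ β : F, delta2 β = (Fintype.card F - 1) ^ 2 := by
  classical
  simp only [delta2, Nat.card_eq_fintype_card, Fintype.card_subtype]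
  rw [← card_eq_sum_card_fiberwise
    (f := fun p : Fˣ × Fˣ => (p.1 : F) + (p.1 : F)⁻¹ + (p.2 : F) + (p.2 : F)⁻¹)
    (fun _ _ => mem_univ _), card_univ, Fintype.card_prod, Fintype.card_units, sq]

open Classical in
/-- The constant in `exists_traceCount_two_eq` is determined by the order of the group. -/
theorem traceCount_two_int (β : F) :
    (traceCount 2 F β : ℤ) = (Fintype.card F : ℤ) ^ 4 *
      (delta2 β + (Fintype.card F : ℤ) ^ 5 - (Fintype.card F : ℤ) ^ 3 - (Fintype.card F : ℤ) ^ 2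
        - 2 * Fintype.card F + 3 +
        if β = 0 then (Fintype.card F : ℤ) ^ 3 - Fintype.card F else 0) := by
  obtain ⟨c, hc⟩ := exists_traceCount_two_eq (F := F)
  have hq : 2 ≤ Fintype.card F := Fintype.one_lt_card
  have hq1 : 1 ≤ Fintype.card F := by omega
  have hq2 : 1 ≤ Fintype.card F ^ 2 := Nat.one_le_pow _ _ hq1
  have hq4 : 1 ≤ Fintype.card F ^ 4 := Nat.one_le_pow _ _ hq1
  have hcard := card_Sp_two (F := F)
  have hδ := sum_delta2 (F := F)
  rw [← sum_traceCount] at hcard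
  have hc' : ∀ β : F, (traceCount 2 F β : ℤ) = (Fintype.card F : ℤ) ^ 4 * delta2 β +
      ((Fintype.card F - 1) * (Fintype.card F - 2) * (Fintype.card F : ℤ) ^ 4 + c) +
      if β = 0 then (Fintype.card F : ℤ) ^ 7 - (Fintype.card F : ℤ) ^ 5 else 0 := by
    intro β
    rw [hc]
    split_ifs <;> push_cast [hq, hq1] <;> ring
  zify [hq1, hq2, hq4] at hcard hδ
  simp only [hc', sum_add_distrib, ← mul_sum, hδ, sum_const, card_univ, nsmul_eq_mul, sum_ite_eq',
    mem_univ, if_true] at hcard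
  have hq0 : (Fintype.card F : ℤ) ≠ 0 := by exact_mod_cast Fintype.card_ne_zero (α := F)
  rw [hc']
  generalize (Fintype.card F : ℤ) = q at *
  have h : ((q - 1) * (q - 2) * q ^ 4 + c) = q ^ 4 * (q ^ 5 - q ^ 3 - q ^ 2 - 2 * q + 3) :=
    mul_left_cancel₀ hq0 (by linear_combination hcard)
  rw [h]
  split_ifs <;> ring

open Classical in
theorem traceCount_two (hq : 3 ≤ Fintype.card F) (β : F) :
    traceCount 2 F β =
      if β = 0 then Fintype.card F ^ 4 *
        (delta2 β + Fintype.card F ^ 5 - Fintype.card F ^ 2 - 3 * Fintype.card F + 3)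
      else Fintype.card F ^ 4 * (delta2 β + Fintype.card F ^ 5 - Fintype.card F ^ 3 -
        Fintype.card F ^ 2 - 2 * Fintype.card F + 3) := by
  have h := traceCount_two_int β
  generalize Fintype.card F = q at *
  -- no truncation occurs in the subtractions of natural numbers
  have h1 : q ≤ q ^ 2 := Nat.le_self_pow two_ne_zero q
  have h2 : 3 * q ^ 2 ≤ q ^ 3 := by rw [pow_succ' q 2]; exact Nat.mul_le_mul_right _ hq
  have h3 : 3 * q ^ 3 ≤ q ^ 4 := by rw [pow_succ' q 3]; exact Nat.mul_le_mul_right _ hq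
  have h4 : 3 * q ^ 4 ≤ q ^ 5 := by rw [pow_succ' q 4]; exact Nat.mul_le_mul_right _ hq
  split_ifs at h ⊢
  · have e1 : q ^ 2 ≤ delta2 β + q ^ 5 := by omega
    have e2 : 3 * q ≤ delta2 β + q ^ 5 - q ^ 2 := by omega
    zify [e1, e2]
    rw [h]
    ring
  · have e1 : q ^ 3 ≤ delta2 β + q ^ 5 := by omega
    have e2 : q ^ 2 ≤ delta2 β + q ^ 5 - q ^ 3 := by omega
    have e3 : 2 * q ≤ delta2 β + q ^ 5 - q ^ 3 - q ^ 2 := by omega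
    zify [e1, e2, e3]
    rw [h]
    ring

end

end

/-! ### Gauss sums, codes and moments -/

section

open Finset

section

variable {F : Type*} [Field F] [Fintype F] [Algebra (ZMod 3) F]

theorem gaussSum_Sp_two {N : ℕ} (g : Fin N ≃ Sp 2 F) (a : Fˣ) :
    ∑ k, canonicalChar F (a * (g k : Matrix (Fin 2 ⊕ Fin 2) (Fin 2 ⊕ Fin 2) F).trace) =
      (Fintype.card F : ℂ) ^ 4 * (kloosterman (canonicalChar F) (a ^ 2) ^ 2 +
        (Fintype.card F : ℂ) ^ 3 - Fintype.card F) := by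
  classical
  rw [sum_canonicalChar_trace]
  have h1 : ∀ β : F, (traceCount 2 F β : ℂ) * canonicalChar F (a * β) =
      (Fintype.card F : ℂ) ^ 4 * (delta2 β * canonicalChar F (a * β)) +
      ((Fintype.card F : ℂ) ^ 4 * ((Fintype.card F : ℂ) ^ 5 - (Fintype.card F : ℂ) ^ 3 -
        (Fintype.card F : ℂ) ^ 2 - 2 * Fintype.card F + 3)) * canonicalChar F (a * β) +
      if β = 0 then (Fintype.card F : ℂ) ^ 4 * ((Fintype.card F : ℂ) ^ 3 - Fintype.card F)
        else 0 := by
    intro β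
    have h2 := congrArg (Int.cast (R := ℂ)) (traceCount_two_int β)
    push_cast at h2
    rw [h2]
    split_ifs with h3
    · rw [h3, mul_zero, AddChar.map_zero_eq_one]
      ring
    · ring
  simp only [h1, sum_add_distrib, ← mul_sum, sum_delta2_mul_canonicalChar, sum_canonicalChar_unit,
    sum_ite_eq', mem_univ, if_true]
  ring

theorem weightCount_code {n N : ℕ} (g : Fin N ≃ Sp n F) (j : ℕ) :
    weightCount (code g) j =
      ∑ p ∈ indexSet F j, ∏ β, trinomial (traceCount n F β) (p.1 β) (p.2 β) := by
  classical
  rw [code_eq_orthogonalCode, weightCount_orthogonalCode]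
  refine sum_congr rfl fun p _ => prod_congr rfl fun β _ => ?_
  rw [traceCount, ← Nat.card_congr (g.subtypeEquiv (p := fun k =>
    (g k : Matrix (Fin n ⊕ Fin n) (Fin n ⊕ Fin n) F).trace = β) fun k => Iff.rfl),
    Nat.card_eq_fintype_card, Fintype.card_subtype]

open Classical in
/-- Splitting a product over the traces according to the quadratic character of `β ^ 2 - 1`. -/
theorem prod_trinomial_one (ν μ : F → ℕ) :
    ∏ β, trinomial (traceCount 1 F β) (ν β) (μ β) =
      trinomial (Fintype.card F ^ 2) (ν 1) (μ 1) * trinomial (Fintype.card F ^ 2) (ν (-1)) (μ (-1)) *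
        (∏ β : F with β ^ 2 - 1 ≠ 0 ∧ IsSquare (β ^ 2 - 1),
          trinomial (Fintype.card F ^ 2 + Fintype.card F) (ν β) (μ β)) *
        ∏ β : F with ¬ IsSquare (β ^ 2 - 1),
          trinomial (Fintype.card F ^ 2 - Fintype.card F) (ν β) (μ β) := by
  have h1 : ∀ β : F, (β = 1 ∨ β = -1) ↔ β ^ 2 - 1 = 0 := fun β => by
    rw [sub_eq_zero, sq, mul_self_eq_one_iff]
  have h2 : ({β : F | β = 1 ∨ β = -1} : Finset F) = {1, -1} := by
    ext; simp
  have h3 : ({β : F | ¬(β = 1 ∨ β = -1) ∧ IsSquare (β ^ 2 - 1)} : Finset F) =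
      ({β : F | β ^ 2 - 1 ≠ 0 ∧ IsSquare (β ^ 2 - 1)} : Finset F) := by
    ext β; simp only [h1, ne_eq]
  have h4 : ({β : F | ¬(β = 1 ∨ β = -1) ∧ ¬IsSquare (β ^ 2 - 1)} : Finset F) =
      ({β : F | ¬IsSquare (β ^ 2 - 1)} : Finset F) := by
    refine filter_congr fun β _ => ?_
    rw [and_iff_right_iff_imp, h1]
    intro h h0
    exact h (h0 ▸ IsSquare.zero)
  rw [← prod_filter_mul_prod_filter_not univ (fun β : F => β = 1 ∨ β = -1), h2,
    prod_pair (ne_neg_self one_ne_zero),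
    ← prod_filter_mul_prod_filter_not (univ.filter fun β : F => ¬(β = 1 ∨ β = -1))
      (fun β : F => IsSquare (β ^ 2 - 1)), filter_filter, filter_filter, h3, h4,
    traceCount_one, traceCount_one, if_pos (Or.inl rfl), if_pos (Or.inr rfl), mul_assoc _ (∏ _ ∈ _, _)]
  refine congrArg _ (congrArg₂ _ (prod_congr rfl fun β hβ => ?_) (prod_congr rfl fun β hβ => ?_))
  · have h := (mem_filter.1 hβ).2
    rw [traceCount_one, if_neg fun h0 => h.1 ((h1 β).1 h0), if_pos h.2]
  · have h := (mem_filter.1 hβ).2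
    rw [traceCount_one, if_neg fun h0 => h ((h1 β).1 h0 ▸ IsSquare.zero), if_neg h]

open Classical in
theorem SK_one_recursion {N : ℕ} (g : Fin N ≃ Sp 1 F) {h : ℕ} (hh : 1 ≤ h) :
    SK F h =
      ∑ j ∈ range h,
        (-1 : ℂ) ^ (h + j + 1) * (h.choose j : ℂ) * ((Fintype.card F : ℂ) ^ 2 - 1) ^ (h - j) * SK F j
      + (Fintype.card F : ℂ) ^ (1 - (h : ℤ)) *
        ∑ j ∈ range (min N h + 1),
          (-1 : ℂ) ^ (h + j) * (weightCount (code g) j : ℂ) *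
            ∑ t ∈ Icc j h,
              (t.factorial : ℂ) * (Nat.stirlingSecond h t : ℂ) * 3 ^ (h - t) *
                (2 : ℂ) ^ ((t : ℤ) - h - j - 1) * (chooseSub N j t : ℂ) := by
  have hq0 : (Fintype.card F : ℂ) ≠ 0 := by exact_mod_cast Fintype.card_ne_zero (α := F)
  have hN : (N : ℂ) = Fintype.card F * ((Fintype.card F : ℂ) ^ 2 - 1) := by
    have h1 : N = Nat.card (Sp 1 F) := by rw [← Nat.card_congr g, Nat.card_fin]
    rw [h1, card_Sp_one, Nat.cast_mul, Nat.cast_sub (Nat.one_le_pow _ _ Fintype.card_pos)]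
    push_cast
    rfl
  rw [code_eq_orthogonalCode, zpow_sub₀ hq0, zpow_one, zpow_natCast, div_eq_mul_inv]
  exact moment_recursion _ (Fintype.card F : ℂ) _ hq0 (fun b => kloosterman (canonicalChar F) b)
    (fun a => by rw [gaussSum_Sp_one, hN]; ring) hh

open Classical in
theorem SK_two_recursion {N : ℕ} (g : Fin N ≃ Sp 2 F) {h : ℕ} (hh : 1 ≤ h) :
    SK F (2 * h) =
      ∑ j ∈ range h,
        (-1 : ℂ) ^ (h + j + 1) * (h.choose j : ℂ) *
          ((Fintype.card F : ℂ) ^ 6 - (Fintype.card F : ℂ) ^ 4 - (Fintype.card F : ℂ) ^ 3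
            - (Fintype.card F : ℂ) ^ 2 + (Fintype.card F : ℂ) + 1) ^ (h - j) * SK F (2 * j)
      + (Fintype.card F : ℂ) ^ (1 - 4 * (h : ℤ)) *
        ∑ j ∈ range (min N h + 1),
          (-1 : ℂ) ^ (h + j) * (weightCount (code g) j : ℂ) *
            ∑ t ∈ Icc j h,
              (t.factorial : ℂ) * (Nat.stirlingSecond h t : ℂ) * 3 ^ (h - t) *
                (2 : ℂ) ^ ((t : ℤ) - h - j - 1) * (chooseSub N j t : ℂ) := by
  have hq0 : (Fintype.card F : ℂ) ≠ 0 := by exact_mod_cast Fintype.card_ne_zero (α := F)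
  have hN : (N : ℂ) = (Fintype.card F : ℂ) ^ 4 * ((Fintype.card F : ℂ) ^ 2 - 1) *
      ((Fintype.card F : ℂ) ^ 4 - 1) := by
    have h1 : N = Nat.card (Sp 2 F) := by rw [← Nat.card_congr g, Nat.card_fin]
    rw [h1, card_Sp_two, Nat.cast_mul, Nat.cast_mul,
      Nat.cast_sub (Nat.one_le_pow _ _ Fintype.card_pos),
      Nat.cast_sub (Nat.one_le_pow _ _ Fintype.card_pos)]
    push_cast
    rfl
  have hpow : (Fintype.card F : ℂ) ^ (1 - 4 * (h : ℤ)) =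
      Fintype.card F * (((Fintype.card F : ℂ) ^ 4) ^ h)⁻¹ := by
    rw [zpow_sub₀ hq0, zpow_one, zpow_mul, zpow_natCast, div_eq_mul_inv]
    norm_cast
  have hSK : ∀ j, SK F (2 * j) =
      ∑ b : Fˣ with IsSquare b, (kloosterman (canonicalChar F) b ^ 2) ^ j := by
    intro j
    simp only [← pow_mul]
    rfl
  simp only [hSK]
  rw [code_eq_orthogonalCode, hpow]
  exact moment_recursion _ ((Fintype.card F : ℂ) ^ 4) _ (pow_ne_zero 4 hq0)
    (fun b => kloosterman (canonicalChar F) b ^ 2)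
    (fun a => by rw [gaussSum_Sp_two, hN]; ring) hh

end

end

end SymplecticCodes

open SymplecticCodes in
open Classical in
theorem theorem1 {F : Type*} [Field F] [Fintype F] [Algebra (ZMod 3) F]
    (q r : ℕ) (hr : 0 < r) (hq : q = 3 ^ r) (hF : Fintype.card F = q)
    (N₁ N₂ : ℕ) (g₁ : Fin N₁ ≃ Sp 1 F) (g₂ : Fin N₂ ≃ Sp 2 F) :
    -- the explicit formula for the Stirling numbers of the second kind
    (∀ h t : ℕ, (Nat.stirlingSecond h t : ℚ) =
      1 / (t.factorial : ℚ) *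
        ∑ j ∈ Finset.range (t + 1), (-1 : ℚ) ^ (t - j) * (t.choose j : ℚ) * (j : ℚ) ^ h) ∧
    -- part (a)
    (N₁ = q * (q ^ 2 - 1) ∧
      (∀ h : ℕ, 1 ≤ h →
        SK F h =
          ∑ j ∈ Finset.range h,
            (-1 : ℂ) ^ (h + j + 1) * (h.choose j : ℂ) * ((q : ℂ) ^ 2 - 1) ^ (h - j) * SK F j
          + (q : ℂ) ^ (1 - (h : ℤ)) *
            ∑ j ∈ Finset.range (min N₁ h + 1),
              (-1 : ℂ) ^ (h + j) * (weightCount (code g₁) j : ℂ) *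
                ∑ t ∈ Finset.Icc j h,
                  (t.factorial : ℂ) * (Nat.stirlingSecond h t : ℂ) * 3 ^ (h - t) *
                    (2 : ℂ) ^ ((t : ℤ) - h - j - 1) * (chooseSub N₁ j t : ℂ)) ∧
      (∀ j : ℕ, j ≤ N₁ →
        weightCount (code g₁) j =
          ∑ p ∈ indexSet F j,
            trinomial (q ^ 2) (p.1 1) (p.2 1) * trinomial (q ^ 2) (p.1 (-1)) (p.2 (-1)) *
            (∏ β : F with β ^ 2 - 1 ≠ 0 ∧ IsSquare (β ^ 2 - 1),
              trinomial (q ^ 2 + q) (p.1 β) (p.2 β)) *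
            ∏ β : F with ¬ IsSquare (β ^ 2 - 1), trinomial (q ^ 2 - q) (p.1 β) (p.2 β)) ∧
      (∀ β : F, traceCount 1 F β =
        if β = 1 ∨ β = -1 then q ^ 2
        else if IsSquare (β ^ 2 - 1) then q ^ 2 + q else q ^ 2 - q)) ∧
    -- part (b)
    (N₂ = q ^ 4 * (q ^ 2 - 1) * (q ^ 4 - 1) ∧
      (∀ h : ℕ, 1 ≤ h →
        SK F (2 * h) =
          ∑ j ∈ Finset.range h,
            (-1 : ℂ) ^ (h + j + 1) * (h.choose j : ℂ) *
              ((q : ℂ) ^ 6 - (q : ℂ) ^ 4 - (q : ℂ) ^ 3 - (q : ℂ) ^ 2 + (q : ℂ) + 1) ^ (h - j) *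
              SK F (2 * j)
          + (q : ℂ) ^ (1 - 4 * (h : ℤ)) *
            ∑ j ∈ Finset.range (min N₂ h + 1),
              (-1 : ℂ) ^ (h + j) * (weightCount (code g₂) j : ℂ) *
                ∑ t ∈ Finset.Icc j h,
                  (t.factorial : ℂ) * (Nat.stirlingSecond h t : ℂ) * 3 ^ (h - t) *
                    (2 : ℂ) ^ ((t : ℤ) - h - j - 1) * (chooseSub N₂ j t : ℂ)) ∧
      (∀ j : ℕ, j ≤ N₂ →
        weightCount (code g₂) j =
          ∑ p ∈ indexSet F j,
            trinomial (q ^ 4 * (delta2 (0 : F) + q ^ 5 - q ^ 2 - 3 * q + 3)) (p.1 0) (p.2 0) *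
            ∏ β : F with β ≠ 0,
              trinomial (q ^ 4 * (delta2 β + q ^ 5 - q ^ 3 - q ^ 2 - 2 * q + 3))
                (p.1 β) (p.2 β)) ∧
      (∀ β : F, traceCount 2 F β =
        if β = 0 then q ^ 4 * (delta2 β + q ^ 5 - q ^ 2 - 3 * q + 3)
        else q ^ 4 * (delta2 β + q ^ 5 - q ^ 3 - q ^ 2 - 2 * q + 3))) := by
  subst hF
  have hq3 : 3 ≤ Fintype.card F := by
    rw [hq]
    exact Nat.le_self_pow hr.ne' 3
  refine ⟨fun h t => ?_, ⟨?_, fun h hh => SK_one_recursion g₁ hh, fun j _ => ?_, traceCount_one⟩,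
    ?_, fun h hh => SK_two_recursion g₂ hh, fun j _ => ?_, traceCount_two hq3⟩
  · rw [← factorial_mul_stirlingSecond, one_div,
      inv_mul_cancel_left₀ (Nat.cast_ne_zero.2 (Nat.factorial_ne_zero t))]
  · rw [← card_Sp_one, ← Nat.card_congr g₁, Nat.card_fin]
  · simp only [weightCount_code, prod_trinomial_one]
  · rw [← card_Sp_two, ← Nat.card_congr g₂, Nat.card_fin]
  · rw [weightCount_code]
    refine Finset.sum_congr rfl fun p _ => ?_
    rw [← Finset.mul_prod_erase _ _ (Finset.mem_univ 0), traceCount_two hq3, if_pos rfl,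
      Finset.filter_ne']
    refine congrArg _ (Finset.prod_congr rfl fun β hβ => ?_)
    rw [traceCount_two hq3, if_neg (Finset.ne_of_mem_erase hβ)]
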